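/- Let $t\ge 1$ and let $F=\bigcup_{i=1}^{t}K_{1,p_i}$ be the star forest that is the vertex-disjoint union of the stars $K_{1,p_1},\dots,K_{1,p_t}$, where $p_1\ge 3$ and $p_1\ge p_2\ge\cdots\ge p_t\ge 1$. Let $s=\max\{i : 1\le i\le t,\ p_i\ge 2\}$. Let $ar(K_n,F)$ be the maximum number of colors in an edge-coloring of the complete graph $K_n$ that has no rainbow copy of $F$ (a copy is rainbow if all its edges have different colors). Then for every $n\ge 3t^2(p_1+1)^2$, $$ar(K_n,F)=\max\left\{\max_{1\le i\le s}\left\{(i-1)n-\binom{i}{2}+\left\lfloor\frac{p_i-2}{2}(n-i+1)\right\rfloor+1\right\},\ (t-2)n-\binom{t-1}{2}+r\right\},$$ where $r=1$ if $p_{t-1}=1$ and $r=2$ otherwise (for $t=1$, where $p_{0}$ is not defined, $r$ may be either $1$ or $2$; the last term is then negative and does not affect the maximum). -/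

import Mathlib

/-- The star forest with components `K_{1, p i}`, `i : ι`: the disjoint union of these stars. -/
def starForest {ι : Type*} (p : ι → ℕ) : SimpleGraph (Σ i : ι, Fin 1 ⊕ Fin (p i)) :=
  ⨆ i : ι, (completeBipartiteGraph (Fin 1) (Fin (p i))).map
    (Function.Embedding.sigmaMk (β := fun i : ι => Fin 1 ⊕ Fin (p i)) i)

/-- The copy `f` of `F` in `G` is rainbow for the edge-coloring `c` of `G`:
its edges have pairwise different colors. -/
def IsRainbowCopy {W V K : Type*} {F : SimpleGraph W} {G : SimpleGraph V}
    (c : G.EdgeLabeling K) (f : F.Copy G) : Prop :=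
  Function.Injective fun e : F.edgeSet => c (f.toHom.mapEdgeSet e)

/-- The numbers `k` such that some edge-coloring of `K_n` with exactly `k` colors
has no rainbow copy of `F`. -/
def antiRamseySet {W : Type*} (n : ℕ) (F : SimpleGraph W) : Set ℕ :=
  {k | ∃ c : (⊤ : SimpleGraph (Fin n)).EdgeLabeling (Fin k),
    Function.Surjective (fun e => c e) ∧
      ∀ f : F.Copy (⊤ : SimpleGraph (Fin n)), ¬ IsRainbowCopy c f}

/-- The anti-Ramsey number `ar(K_n, F)`. -/
noncomputable def antiRamsey {W : Type*} (n : ℕ) (F : SimpleGraph W) : ℕ :=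
  sSup (antiRamseySet n F)

/-- The supremum in the definition of `antiRamsey` is a maximum as soon as the set is nonempty. -/
theorem isGreatest_antiRamsey {W : Type*} (n : ℕ) (F : SimpleGraph W)
    (h : (antiRamseySet n F).Nonempty) : IsGreatest (antiRamseySet n F) (antiRamsey n F) := by
  have hb : BddAbove (antiRamseySet n F) := by
    refine ⟨Nat.card (⊤ : SimpleGraph (Fin n)).edgeSet, ?_⟩
    rintro k ⟨c, hc, -⟩
    simpa using Nat.card_le_card_of_surjective _ hc
  exact ⟨Nat.sSup_mem h hb, fun k hk => le_csSup hb hk⟩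

/-! Lower bound. Choose `k` vertices, give pairwise different colors to all edges meeting them and
to the edges of a sparse graph `E` on the other vertices, and one further color to everything else.
For `k = i - 1` and `E` nearly regular of degree `p_i - 2`, one of the `i` largest stars of a copy
avoids the chosen vertices, but a center sees at most `p_i - 1` colors among the others. For `k = t
- 2` and `E` with `r - 1` edges, two stars avoid the chosen vertices, and only `r` colors are left
for them. See `le_antiRamsey_of_near_regular` and `le_antiRamsey_of_two_stars`.

Upper bound (`exists_rainbowForest`), by induction on the number of stars. If some vertex `v` of an
`m`-set sees many colors, deleting it loses at most `m - 1` colors. This is exactly the difference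
between the bound with index `i + 1` on `m` vertices and the one with index `i` on `m - 1`, so
induction yields all stars but the largest, and that one is attached at `v`. If every vertex sees
few colors, the single-star bound `two_mul_card_colors_le` gives a rainbow largest star. Drop its
vertices and all colors they see, and keep one edge of each remaining color: this rainbow graph has
average degree above `p_2 - 1` and bounded maximum degree, so the other stars are found greedily
(`exists_rainbowForest_of_isTransversal`). The size of `n` absorbs all losses.

The bounded case needs about `p_2 m / 2` colors. Only two edges, or a two-edge star with an edge,
escape this count; these pairs can appear after deletions although `p_1 ≥ 3`, and are treated by
hand. -/

/-! ### Colors seen by a vertex, and the bound for a single star. -/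

section Coloring

variable {α κ : Type*} [DecidableEq κ]

/-- The colors of the pairs inside `S`. -/
def colors (c : α → α → κ) (S : Finset α) : Finset κ :=
  S.offDiag.image fun e => c e.1 e.2

theorem mem_colors {c : α → α → κ} {S : Finset α} {χ : κ} :
    χ ∈ colors c S ↔ ∃ x ∈ S, ∃ y ∈ S, x ≠ y ∧ c x y = χ := by
  simp only [colors, Finset.mem_image, Finset.mem_offDiag, Prod.exists]
  constructor
  · rintro ⟨a, b, ⟨ha, hb, hab⟩, h⟩
    exact ⟨a, ha, b, hb, hab, h⟩
  · rintro ⟨a, ha, b, hb, hab, h⟩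
    exact ⟨a, b, ⟨ha, hb, hab⟩, h⟩

variable [DecidableEq α]

/-- The colors of the pairs inside `S` that contain `v`. -/
def colorsAt (c : α → α → κ) (S : Finset α) (v : α) : Finset κ :=
  (S.erase v).image (c v)

/-- `RainbowForest c t p U C`: there are disjoint stars with `p 0, …, p (t - 1)` leaves, together
rainbow, with vertex set `U` and set of colors `C`. -/
def RainbowForest (c : α → α → κ) : ℕ → (ℕ → ℕ) → Finset α → Finset κ → Prop
  | 0, _, U, C => U = ∅ ∧ C = ∅
  | t + 1, p, U, C => ∃ v L U' C', RainbowForest c t (fun i => p (i + 1)) U' C' ∧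
      v ∉ L ∧ v ∉ U' ∧ Disjoint L U' ∧ L.card = p 0 ∧ Set.InjOn (c v) L ∧
      Disjoint (L.image (c v)) C' ∧ U = insert v (L ∪ U') ∧ C = L.image (c v) ∪ C'

theorem mem_colorsAt {c : α → α → κ} {S : Finset α} {v : α} {χ : κ} :
    χ ∈ colorsAt c S v ↔ ∃ x ∈ S, x ≠ v ∧ c v x = χ := by
  simp only [colorsAt, Finset.mem_image, Finset.mem_erase]
  constructor
  · rintro ⟨x, ⟨h1, h2⟩, h⟩
    exact ⟨x, h2, h1, h⟩
  · rintro ⟨x, h2, h1, h⟩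
    exact ⟨x, ⟨h1, h2⟩, h⟩

theorem colorsAt_subset_colors {c : α → α → κ} {S : Finset α} {v : α} (hv : v ∈ S) :
    colorsAt c S v ⊆ colors c S := by
  intro χ h
  obtain ⟨x, hx, hxv, rfl⟩ := mem_colorsAt.1 h
  exact mem_colors.2 ⟨v, hv, x, hx, hxv.symm, rfl⟩

theorem exists_injOn_subset_card_eq {f : α → κ} {T : Finset α} {q : ℕ}
    (h : q ≤ (T.image f).card) : ∃ L ⊆ T, L.card = q ∧ Set.InjOn f L := by
  classical
  obtain ⟨C, hC, hq⟩ := Finset.exists_subset_card_eq h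
  have : ∀ χ ∈ C, ∃ x ∈ T, f x = χ := fun χ hχ => Finset.mem_image.1 (hC hχ)
  choose g hg hfg using this
  refine ⟨C.attach.image fun χ => g χ.1 χ.2, ?_, ?_, ?_⟩
  · intro x hx
    obtain ⟨χ, -, rfl⟩ := Finset.mem_image.1 hx
    exact hg _ _
  · rw [Finset.card_image_of_injective, Finset.card_attach, hq]
    intro χ χ' hh
    have := congrArg f hh
    simp only [hfg] at this
    exact Subtype.ext this
  · intro x hx y hy hxy
    obtain ⟨χ, -, rfl⟩ := Finset.mem_image.1 (Finset.mem_coe.1 hx)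
    obtain ⟨χ', -, rfl⟩ := Finset.mem_image.1 (Finset.mem_coe.1 hy)
    simp only [hfg] at hxy
    have : χ = χ' := Subtype.ext hxy
    rw [this]

theorem RainbowForest.card_le {c : α → α → κ} {t : ℕ} {p : ℕ → ℕ} {P : ℕ} {U : Finset α}
    {C : Finset κ} (h : RainbowForest c t p U C) (hp : ∀ i < t, p i ≤ P) :
    U.card ≤ t * (P + 1) ∧ C.card ≤ t * P := by
  induction t generalizing p U C with
  | zero => obtain ⟨rfl, rfl⟩ := h; simp
  | succ t ih =>
    obtain ⟨v, L, U', C', hF, -, -, -, hL, -, -, rfl, rfl⟩ := h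
    obtain ⟨h1, h2⟩ := ih hF fun i hi => hp (i + 1) (by omega)
    have h0 := hp 0 (by omega)
    have a1 := Finset.card_insert_le v (L ∪ U')
    have a2 := Finset.card_union_le L U'
    have a3 := Finset.card_union_le (L.image (c v)) C'
    have a4 : (L.image (c v)).card ≤ L.card := Finset.card_image_le
    constructor <;> rw [Nat.succ_mul] <;> omega

theorem card_colors_le_erase {c : α → α → κ} (hc : ∀ x y, c x y = c y x) (S : Finset α) (v : α) :
    (colors c S).card ≤ (colors c (S.erase v)).card + (colorsAt c S v).card := by
  refine le_trans (Finset.card_le_card ?_) (Finset.card_union_le _ _)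
  intro χ h
  obtain ⟨x, hx, y, hy, hxy, rfl⟩ := mem_colors.1 h
  rw [Finset.mem_union]
  by_cases hxv : x = v
  · subst hxv; exact Or.inr (mem_colorsAt.2 ⟨y, hy, hxy.symm, rfl⟩)
  by_cases hyv : y = v
  · subst hyv; exact Or.inr (mem_colorsAt.2 ⟨x, hx, hxy, hc _ _⟩)
  · exact Or.inl (mem_colors.2 ⟨x, by simp [*], y, by simp [*], hxy, rfl⟩)

theorem card_colorsAt_lt {c : α → α → κ} {S : Finset α} {v : α} (hv : v ∈ S) :
    (colorsAt c S v).card + 1 ≤ S.card := by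
  have h : (colorsAt c S v).card ≤ (S.erase v).card := Finset.card_image_le
  have := Finset.card_erase_add_one hv
  omega

/-- The anti-Ramsey bound for a single star: a coloring with at most `r + 1` colors at each vertex
has at most `r m / 2 + 1` colors. -/
theorem two_mul_card_colors_le {c : α → α → κ} (hc : ∀ x y, c x y = c y x) {S : Finset α} {r : ℕ}
    (hS : (r + 1) * r + 1 < S.card) (hdeg : ∀ v ∈ S, (colorsAt c S v).card ≤ r + 1) :
    2 * (colors c S).card ≤ r * S.card + 2 := by
  classical
  by_contra! hk
  set V : κ → Finset α := fun χ => S.filter fun v => χ ∈ colorsAt c S v with hV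
  have hsum : ∑ χ ∈ colors c S, (V χ).card = ∑ v ∈ S, (colorsAt c S v).card := by
    have := Finset.sum_card_bipartiteAbove_eq_sum_card_bipartiteBelow (s := colors c S) (t := S)
      (fun χ v => χ ∈ colorsAt c S v)
    simp only [Finset.bipartiteAbove, Finset.bipartiteBelow] at this
    rw [hV, this]
    refine Finset.sum_congr rfl fun v hv => ?_
    rw [Finset.filter_mem_eq_inter, Finset.inter_eq_right.2 (colorsAt_subset_colors hv)]
  have hmem : ∀ {x y}, x ∈ S → y ∈ S → x ≠ y → x ∈ V (c x y) ∧ y ∈ V (c x y) := by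
    intro x y hx hy hxy
    exact ⟨Finset.mem_filter.2 ⟨hx, mem_colorsAt.2 ⟨y, hy, hxy.symm, rfl⟩⟩,
      Finset.mem_filter.2 ⟨hy, mem_colorsAt.2 ⟨x, hx, hxy, hc _ _⟩⟩⟩
  have hV2 : ∀ χ ∈ colors c S, 2 ≤ (V χ).card := by
    intro χ h
    obtain ⟨x, hx, y, hy, hxy, rfl⟩ := mem_colors.1 h
    rw [← Finset.card_pair hxy]
    apply Finset.card_le_card
    intro z hz
    rcases Finset.mem_insert.1 hz with rfl | hz
    · exact (hmem hx hy hxy).1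
    · rw [Finset.mem_singleton.1 hz]; exact (hmem hx hy hxy).2
  -- Every color meets at least two vertices. Having at least `(r m + 3) / 2` colors, with `m =
  -- S.card`, caps the total excess over two at `m - 3`.
  have htot : ∑ χ ∈ colors c S, (((V χ).card : ℤ) - 2) ≤ S.card - 3 := by
    have h1 : ∑ v ∈ S, (colorsAt c S v).card ≤ S.card * (r + 1) := by
      simpa using Finset.sum_le_card_nsmul S _ _ hdeg
    rw [← hsum] at h1
    rw [Finset.sum_sub_distrib, Finset.sum_const, nsmul_eq_mul]
    zify at h1 hk
    nlinarith
  have hle : ∀ X ⊆ colors c S, ∑ χ ∈ X, (((V χ).card : ℤ) - 2) ≤ S.card - 3 := by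
    intro X hX
    refine le_trans (Finset.sum_le_sum_of_subset_of_nonneg hX fun χ h _ => ?_) htot
    have := hV2 χ h
    zify at this
    linarith
  obtain ⟨v, hv⟩ : S.Nonempty := Finset.card_pos.1 (by omega)
  -- Pigeonhole: more than `(r + 1) r` edges at `v` share at most `r + 1` colors. The repeated color
  -- has excess at least `r`.
  obtain ⟨χ, hχ, hχr⟩ : ∃ χ ∈ colorsAt c S v,
      r < ((S.erase v).filter fun x => c v x = χ).card := by
    apply Finset.exists_lt_card_fiber_of_mul_lt_card_of_maps_to
    · intro x hx; exact Finset.mem_image_of_mem _ hx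
    · have h1 := Nat.mul_le_mul_right r (hdeg v hv)
      have := Finset.card_erase_add_one hv
      omega
  have hχV : r + 2 ≤ (V χ).card := by
    have : (insert v ((S.erase v).filter fun x => c v x = χ)).card ≤ (V χ).card := by
      apply Finset.card_le_card
      intro z hz
      rcases Finset.mem_insert.1 hz with rfl | hz
      · exact Finset.mem_filter.2 ⟨hv, hχ⟩
      · obtain ⟨h1, rfl⟩ := Finset.mem_filter.1 hz
        exact (hmem hv (Finset.mem_of_mem_erase h1) (Finset.ne_of_mem_erase h1).symm).2
    rw [Finset.card_insert_of_notMem (by simp)] at this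
    omega
  have hχS := colorsAt_subset_colors hv hχ
  -- If `χ` meets every vertex, its excess alone is `m - 2`. Otherwise let `w` miss `χ`: the colors
  -- at `w` reach all other vertices, so their excess is at least `(m - 1) - (r + 1)`, and the
  -- excess `r` of `χ` again brings the total to `m - 2`.
  by_cases hall : ∀ w ∈ S, w ∈ V χ
  · have h1 := hle {χ} (by simpa using hχS)
    have h2 : S.card ≤ (V χ).card := Finset.card_le_card hall
    rw [Finset.sum_singleton] at h1
    zify at h2
    linarith
  · push Not at hall
    obtain ⟨w, hw, hwχ⟩ := hall
    have hχw : χ ∉ colorsAt c S w := fun h => hwχ (Finset.mem_filter.2 ⟨hw, h⟩)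
    have h1 := hle (insert χ (colorsAt c S w))
      (Finset.insert_subset hχS (colorsAt_subset_colors hw))
    rw [Finset.sum_insert hχw, Finset.sum_sub_distrib, Finset.sum_const, nsmul_eq_mul] at h1
    have h2 : (S.erase w).card ≤ ∑ χ ∈ colorsAt c S w, ((V χ).erase w).card := by
      refine le_trans (Finset.card_le_card ?_) Finset.card_biUnion_le
      intro x hx
      have hxS := Finset.mem_of_mem_erase hx
      have hxw := Finset.ne_of_mem_erase hx
      exact Finset.mem_biUnion.2 ⟨c w x, mem_colorsAt.2 ⟨x, hxS, hxw, rfl⟩,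
        Finset.mem_erase.2 ⟨hxw, (hmem hw hxS hxw.symm).2⟩⟩
    have h3 : ∀ χ ∈ colorsAt c S w, (((V χ).erase w).card : ℤ) = ((V χ).card : ℤ) - 1 := by
      intro χ h
      have := Finset.card_erase_add_one (s := V χ) (Finset.mem_filter.2 ⟨hw, h⟩)
      zify at this
      linarith
    have h4 := Finset.card_erase_add_one hw
    have h5 := hdeg w hw
    zify at h2 h4 h5 hχV
    rw [Finset.sum_congr rfl h3, Finset.sum_sub_distrib, Finset.sum_const, nsmul_eq_mul] at h2
    linarith

end Coloring

/-! ### One edge per color: star forests inside a rainbow graph. -/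

section Transversal

variable {α κ : Type*} [DecidableEq α]

/-- The colors `χ` of `X` whose chosen edge `{a χ, b χ}` contains `v`. -/
def incident (a b : κ → α) (X : Finset κ) (v : α) : Finset κ :=
  X.filter fun χ => a χ = v ∨ b χ = v

/-- `{a χ, b χ}` is an edge inside `T` of color `χ`, for each `χ` in `X`. -/
def IsTransversal (c : α → α → κ) (a b : κ → α) (X : Finset κ) (T : Finset α) : Prop :=
  ∀ χ ∈ X, a χ ∈ T ∧ b χ ∈ T ∧ a χ ≠ b χ ∧ c (a χ) (b χ) = χ

theorem IsTransversal.sum_card_incident {c : α → α → κ} {a b : κ → α} {X : Finset κ}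
    {T : Finset α} (h : IsTransversal c a b X T) :
    ∑ v ∈ T, (incident a b X v).card = 2 * X.card := by
  have := Finset.sum_card_bipartiteAbove_eq_sum_card_bipartiteBelow (s := T) (t := X)
    (fun v χ => a χ = v ∨ b χ = v)
  simp only [Finset.bipartiteAbove, Finset.bipartiteBelow] at this
  simp only [incident]
  rw [this, mul_comm, ← smul_eq_mul, ← Finset.sum_const]
  refine Finset.sum_congr rfl fun χ hχ => ?_
  obtain ⟨ha, hb, hab, -⟩ := h χ hχ
  rw [← Finset.card_pair hab]
  congr 1
  ext v
  simp only [Finset.mem_filter, Finset.mem_insert, Finset.mem_singleton]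
  constructor
  · rintro ⟨-, rfl | rfl⟩ <;> simp
  · rintro (rfl | rfl) <;> simp [ha, hb]

theorem IsTransversal.exists_leaves {c : α → α → κ} (hc : ∀ x y, c x y = c y x) {a b : κ → α}
    {X : Finset κ} {T : Finset α} (h : IsTransversal c a b X T) (v : α) :
    ∃ N ⊆ T, N.card = (incident a b X v).card ∧ v ∉ N ∧ Set.InjOn (c v) N ∧
      ∀ x ∈ N, c v x ∈ incident a b X v := by
  set leaf : κ → α := fun χ => if a χ = v then b χ else a χ with hleaf
  have key : ∀ χ ∈ incident a b X v, leaf χ ∈ T ∧ leaf χ ≠ v ∧ c v (leaf χ) = χ := by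
    intro χ hχ
    obtain ⟨hX, hv⟩ := Finset.mem_filter.1 hχ
    obtain ⟨ha, hb, hab, hcol⟩ := h χ hX
    by_cases hav : a χ = v
    · simp only [hleaf, hav, if_true]
      exact ⟨hb, fun e => hab (hav.trans e.symm), by rw [← hav]; exact hcol⟩
    · have hbv := hv.resolve_left hav
      simp only [hleaf, hav, if_false]
      exact ⟨ha, hav, by rw [hc, ← hbv]; exact hcol⟩
  refine ⟨(incident a b X v).image leaf, ?_, ?_, ?_, ?_, ?_⟩
  · intro x hx
    obtain ⟨χ, hχ, rfl⟩ := Finset.mem_image.1 hx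
    exact (key χ hχ).1
  · apply Finset.card_image_of_injOn
    intro χ hχ χ' hχ' e
    rw [← (key χ hχ).2.2, ← (key χ' hχ').2.2, e]
  · intro hx
    obtain ⟨χ, hχ, e⟩ := Finset.mem_image.1 hx
    exact (key χ hχ).2.1 e
  · intro x hx y hy e
    obtain ⟨χ, hχ, rfl⟩ := Finset.mem_image.1 (Finset.mem_coe.1 hx)
    obtain ⟨χ', hχ', rfl⟩ := Finset.mem_image.1 (Finset.mem_coe.1 hy)
    rw [(key χ hχ).2.2, (key χ' hχ').2.2] at e
    rw [e]
  · intro x hx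
    obtain ⟨χ, hχ, rfl⟩ := Finset.mem_image.1 hx
    rwa [(key χ hχ).2.2]

theorem IsTransversal.restrict {c : α → α → κ} {a b : κ → α} {X : Finset κ}
    {T : Finset α} (h : IsTransversal c a b X T) (W : Finset α) :
    IsTransversal c a b (X.filter fun χ => a χ ∉ W ∧ b χ ∉ W) (T \ W) := by
  intro χ hχ
  obtain ⟨hX, h1, h2⟩ := Finset.mem_filter.1 hχ
  obtain ⟨ha, hb, hab, hcol⟩ := h χ hX
  exact ⟨Finset.mem_sdiff.2 ⟨ha, h1⟩, Finset.mem_sdiff.2 ⟨hb, h2⟩, hab, hcol⟩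

variable [DecidableEq κ]

theorem card_le_restrict_add (a b : κ → α) (X : Finset κ) (W : Finset α) :
    X.card ≤ (X.filter fun χ => a χ ∉ W ∧ b χ ∉ W).card + ∑ v ∈ W, (incident a b X v).card := by
  refine le_trans (Finset.card_le_card ?_) (le_trans (Finset.card_union_le _ _)
    (Nat.add_le_add_left (Finset.card_biUnion_le (s := W) (t := incident a b X)) _))
  intro χ hχ
  simp only [Finset.mem_union, Finset.mem_filter, Finset.mem_biUnion, incident, hχ, true_and]
  by_cases h1 : a χ ∈ W
  · exact Or.inr ⟨_, h1, Or.inl rfl⟩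
  by_cases h2 : b χ ∈ W
  · exact Or.inr ⟨_, h2, Or.inr rfl⟩
  · exact Or.inl ⟨h1, h2⟩

/-- A star at `v` is added to a forest that comes from the edges of the transversal outside a
set `W` containing `v`. -/
theorem RainbowForest.cons_of_restrict {c : α → α → κ} {a b : κ → α} {X : Finset κ}
    {T W : Finset α} {t : ℕ} {p : ℕ → ℕ} {U : Finset α} {C : Finset κ}
    (hF : RainbowForest c t (fun i => p (i + 1)) U C) (hU : U ⊆ T \ W)
    (hC : C ⊆ X.filter fun χ => a χ ∉ W ∧ b χ ∉ W) {v : α} (hvT : v ∈ T) (hvW : v ∈ W)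
    {L : Finset α} (hLT : L ⊆ T) (hLU : Disjoint L U) (hvL : v ∉ L) (hL : L.card = p 0)
    (hinj : Set.InjOn (c v) L) (hcol : ∀ x ∈ L, c v x ∈ incident a b X v) :
    ∃ U C, RainbowForest c (t + 1) p U C ∧ U ⊆ T ∧ C ⊆ X := by
  refine ⟨_, _, ⟨v, L, U, C, hF, hvL, ?_, hLU, hL, hinj, ?_, rfl, rfl⟩, ?_, ?_⟩
  · exact fun h => (Finset.mem_sdiff.1 (hU h)).2 hvW
  -- The colors of the star have their chosen edge through `v ∈ W`, those of the forest have it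
  -- outside `W`.
  · rw [Finset.disjoint_left]
    intro χ hχ hχC
    obtain ⟨x, hx, rfl⟩ := Finset.mem_image.1 hχ
    obtain ⟨-, h1, h2⟩ := Finset.mem_filter.1 (hC hχC)
    rcases (Finset.mem_filter.1 (hcol x hx)).2 with h | h
    · exact h1 (by rw [h]; exact hvW)
    · exact h2 (by rw [h]; exact hvW)
  · exact Finset.insert_subset hvT
      (Finset.union_subset hLT (hU.trans Finset.sdiff_subset))
  · refine Finset.union_subset ?_ (hC.trans (Finset.filter_subset _ _))
    intro χ hχ
    obtain ⟨x, hx, rfl⟩ := Finset.mem_image.1 hχ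
    exact (Finset.mem_filter.1 (hcol x hx)).1

/-- A Turán-type bound for star forests in graphs of maximum degree at most `D`. -/
theorem exists_rainbowForest_of_isTransversal {c : α → α → κ} (hc : ∀ x y, c x y = c y x)
    {a b : κ → α} {r M D : ℕ} (t : ℕ) {p : ℕ → ℕ} {X : Finset κ} {T : Finset α}
    (h : IsTransversal c a b X T) (hp : ∀ i < t, p i ≤ r + 1) (hT : T.card ≤ M)
    (hdeg : ∀ v, (incident a b X v).card ≤ D) (hD : t * (r + 2) * (r + 2) ≤ D)
    (hX : r * M + 2 * t * D < 2 * X.card) :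
    ∃ U C, RainbowForest c t p U C ∧ U ⊆ T ∧ C ⊆ X := by
  induction t generalizing p X T with
  | zero => exact ⟨∅, ∅, ⟨rfl, rfl⟩, by simp, by simp⟩
  | succ t ih =>
    have hD' : t * (r + 2) * (r + 2) ≤ D := le_trans (by gcongr; omega) hD
    have hp0 := hp 0 (by omega)
    have hdeg' : ∀ W : Finset α, ∀ v,
        (incident a b (X.filter fun χ => a χ ∉ W ∧ b χ ∉ W) v).card ≤ D := fun W v =>
      (Finset.card_le_card (Finset.filter_subset_filter _ (Finset.filter_subset _ _))).trans
        (hdeg v)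
    -- Each round may lose `D` edges, which is what the term `2 * t * D` pays for. `M` only bounds
    -- `T.card`, so the shrinking of `T` needs no accounting.
    have step : ∀ W : Finset α, ∑ v ∈ W, (incident a b X v).card ≤ D →
        ∃ U C, RainbowForest c t (fun i => p (i + 1)) U C ∧ U ⊆ T \ W ∧
          C ⊆ X.filter fun χ => a χ ∉ W ∧ b χ ∉ W := by
      intro W hW
      refine ih (h.restrict W) (fun i hi => hp (i + 1) (by omega))
        ((Finset.card_le_card Finset.sdiff_subset).trans hT) (hdeg' W) hD' ?_
      have := card_le_restrict_add a b X W
      have e : 2 * (t + 1) * D = 2 * t * D + 2 * D := by ring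
      omega
    have hvT : ∀ v, 0 < (incident a b X v).card → v ∈ T := by
      intro v hv
      obtain ⟨χ, hχ⟩ := Finset.card_pos.1 hv
      obtain ⟨hχX, rfl | rfl⟩ := Finset.mem_filter.1 hχ
      · exact (h χ hχX).1
      · exact (h χ hχX).2.1
    -- The remaining `t` stars occupy at most `t * (r + 2)` vertices, so a vertex of this degree can
    -- be saved for last and still has `r + 1` free leaves.
    by_cases hhigh : ∃ v, t * (r + 2) + (r + 1) ≤ (incident a b X v).card
    · obtain ⟨v, hv⟩ := hhigh
      obtain ⟨U, C, hF, hU, hC⟩ := step {v} (by simpa using hdeg v)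
      obtain ⟨N, hNT, hN, hvN, hinj, hcol⟩ := h.exists_leaves hc v
      have hUcard : U.card ≤ t * (r + 2) :=
        (hF.card_le (P := r + 1) fun i hi => hp (i + 1) (by omega)).1
      have : p 0 ≤ (N \ U).card := by
        have := Finset.le_card_sdiff U N
        omega
      obtain ⟨L, hLN, hL⟩ := Finset.exists_subset_card_eq this
      have hLN' : L ⊆ N := hLN.trans Finset.sdiff_subset
      exact hF.cons_of_restrict hU hC (hvT v (by omega)) (by simp) (hLN'.trans hNT)
        (Finset.disjoint_of_subset_left hLN Finset.sdiff_disjoint) (fun h => hvN (hLN' h)) hL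
        (hinj.mono hLN') (fun x hx => hcol x (hLN' hx))
    · push Not at hhigh
      obtain ⟨v, hv, hvr⟩ : ∃ v ∈ T, r < (incident a b X v).card := by
        by_contra! hlow
        have h1 := Finset.sum_le_card_nsmul T _ _ hlow
        rw [h.sum_card_incident, smul_eq_mul] at h1
        have h2 : T.card * r ≤ r * M := by rw [mul_comm]; gcongr
        omega
      obtain ⟨N, hNT, hN, hvN, hinj, hcol⟩ := h.exists_leaves hc v
      obtain ⟨L, hLN, hL⟩ := Finset.exists_subset_card_eq (show p 0 ≤ N.card by omega)
      -- All degrees are now at most `(t + 1) * (r + 2)`, so deleting a whole star of at most `r +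
      -- 2` vertices costs at most `D` edges.
      obtain ⟨U, C, hF, hU, hC⟩ := step (insert v L) (by
        have h1 : ∀ u ∈ insert v L, (incident a b X u).card ≤ (t + 1) * (r + 2) := by
          intro u _
          have := hhigh u
          have e : (t + 1) * (r + 2) = t * (r + 2) + (r + 2) := by ring
          omega
        have h2 := Finset.sum_le_card_nsmul _ _ _ h1
        rw [smul_eq_mul] at h2
        have h3 : (insert v L).card ≤ r + 2 := by
          have := Finset.card_insert_le v L
          omega
        refine h2.trans (le_trans (Nat.mul_le_mul_right _ h3) ?_)
        rwa [mul_comm])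
      refine hF.cons_of_restrict hU hC hv (by simp) (hLN.trans hNT) ?_ (fun h => hvN (hLN h)) hL
        (hinj.mono hLN) (fun x hx => hcol x (hLN hx))
      rw [Finset.disjoint_left]
      intro x hx hxU
      exact (Finset.mem_sdiff.1 (hU hxU)).2 (Finset.mem_insert_of_mem hx)

end Transversal

/-! ### Attaching stars in a colored complete graph. -/

section Coloring

variable {α κ : Type*} [DecidableEq α] [DecidableEq κ]

/-- For `q = 1` any edge serves, so the count is required only for `q ≥ 2`; there it is the
single-star bound with `r = q - 2`. -/
theorem exists_rainbow_star {c : α → α → κ} (hc : ∀ x y, c x y = c y x) {S : Finset α} {q : ℕ}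
    (hq : 1 ≤ q) (hS : q * q + 1 < S.card)
    (hk : 2 ≤ q → (q - 2) * S.card + 2 < 2 * (colors c S).card) :
    ∃ v ∈ S, ∃ L ⊆ S.erase v, L.card = q ∧ Set.InjOn (c v) L := by
  obtain ⟨v, hv, h⟩ : ∃ v ∈ S, q ≤ (colorsAt c S v).card := by
    rcases Nat.lt_or_ge q 2 with h2 | h2
    · obtain ⟨v, hv, w, hw, hvw⟩ := Finset.one_lt_card.1 (show 1 < S.card by omega)
      exact ⟨v, hv, (show q ≤ 1 by omega).trans
        (Finset.card_pos.2 ⟨_, mem_colorsAt.2 ⟨w, hw, hvw.symm, rfl⟩⟩)⟩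
    · obtain ⟨r, rfl⟩ := Nat.exists_eq_add_of_le' h2
      by_contra! hlow
      have := two_mul_card_colors_le hc (S := S) (r := r) (by nlinarith)
        fun v hv => Nat.le_of_lt_succ (hlow v hv)
      have := hk h2
      simp only [Nat.add_sub_cancel] at this
      omega
  obtain ⟨L, h1, h2, h3⟩ := exists_injOn_subset_card_eq h
  exact ⟨v, hv, L, h1, h2, h3⟩

/-- A star is added to a rainbow forest at a vertex that sees many colors. -/
theorem RainbowForest.cons_of_colorsAt {c : α → α → κ} {S : Finset α} {t P : ℕ} {p : ℕ → ℕ}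
    {U : Finset α} {C : Finset κ} (hp : ∀ i < t + 1, p i ≤ P)
    (hF : RainbowForest c t (fun i => p (i + 1)) U C) {v : α} (hv : v ∈ S) (hU : U ⊆ S.erase v)
    (hdeg : t * (2 * P + 1) + P ≤ (colorsAt c S v).card) :
    ∃ U C, RainbowForest c (t + 1) p U C ∧ U ⊆ S := by
  obtain ⟨hU', hC'⟩ := hF.card_le fun i hi => hp (i + 1) (by omega)
  set T := (S.erase v).filter fun x => x ∉ U ∧ c v x ∉ C with hT
  -- The forest blocks at most one color at `v` per vertex and one per color, at most `t * (P + 1) +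
  -- t * P` in all.
  have hle : (colorsAt c S v).card ≤ (T.image (c v)).card + (U.card + C.card) := by
    refine le_trans (Finset.card_le_card (t := T.image (c v) ∪ (U.image (c v) ∪ C)) ?_) ?_
    · intro χ hχ
      obtain ⟨x, hx, rfl⟩ := Finset.mem_image.1 hχ
      simp only [Finset.mem_union]
      by_cases h1 : x ∈ U
      · exact Or.inr (Or.inl (Finset.mem_image_of_mem _ h1))
      by_cases h2 : c v x ∈ C
      · exact Or.inr (Or.inr h2)
      · exact Or.inl (Finset.mem_image_of_mem _ (Finset.mem_filter.2 ⟨hx, h1, h2⟩))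
    · refine (Finset.card_union_le _ _).trans (Nat.add_le_add_left ?_ _)
      exact (Finset.card_union_le _ _).trans (Nat.add_le_add_right Finset.card_image_le _)
  have e : t * (2 * P + 1) = t * (P + 1) + t * P := by ring
  have hp0 := hp 0 (by omega)
  obtain ⟨L, hLT, hL, hinj⟩ := exists_injOn_subset_card_eq (f := c v) (T := T) (q := p 0) (by omega)
  have hmem : ∀ x ∈ L, x ∈ S.erase v ∧ x ∉ U ∧ c v x ∉ C := fun x hx =>
    Finset.mem_filter.1 (hLT hx)
  refine ⟨_, _, ⟨v, L, U, C, hF, fun h => by simpa using (hmem v h).1, fun h => by simpa using hU h,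
    Finset.disjoint_left.2 fun x hx => (hmem x hx).2.1, hL, hinj, ?_, rfl, rfl⟩, ?_⟩
  · rw [Finset.disjoint_left]
    intro χ hχ
    obtain ⟨x, hx, rfl⟩ := Finset.mem_image.1 hχ
    exact (hmem x hx).2.2
  · refine Finset.insert_subset hv (Finset.union_subset ?_ (hU.trans (Finset.erase_subset _ _)))
    exact fun x hx => Finset.mem_of_mem_erase (hmem x hx).1

/-- If no vertex sees more than `B` colors, a rainbow star extends to a rainbow star forest. -/
theorem exists_rainbowForest_of_colorsAt_le {c : α → α → κ} (hc : ∀ x y, c x y = c y x)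
    {S : Finset α} {t r B D : ℕ} {p : ℕ → ℕ} (hp : ∀ i < t, p (i + 1) ≤ r + 1)
    (hB : ∀ v ∈ S, (colorsAt c S v).card ≤ B) (hBD : B ≤ D) (hD : t * (r + 2) * (r + 2) ≤ D)
    (hk : r * S.card + 2 * t * D + 2 * ((p 0 + 1) * B) < 2 * (colors c S).card) {v : α}
    (hv : v ∈ S) {L : Finset α} (hLS : L ⊆ S.erase v) (hL : L.card = p 0)
    (hinj : Set.InjOn (c v) L) :
    ∃ U C, RainbowForest c (t + 1) p U C ∧ U ⊆ S := by
  classical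
  set W := insert v L with hW
  have hWS : W ⊆ S := Finset.insert_subset hv (hLS.trans (Finset.erase_subset _ _))
  -- An edge with a color in `X` avoids the star entirely, and the colors of the star are not in `X`
  -- because `v` sees them. At most `(p 0 + 1) * B` colors are discarded.
  set X := colors c S \ W.biUnion (colorsAt c S) with hX
  have hend : ∀ χ : κ, ∃ e : α × α, χ ∈ X → e.1 ∈ S \ W ∧ e.2 ∈ S \ W ∧ e.1 ≠ e.2 ∧
      c e.1 e.2 = χ := by
    intro χ
    by_cases hχ : χ ∈ X
    · obtain ⟨h1, h2⟩ := Finset.mem_sdiff.1 hχ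
      obtain ⟨x, hx, y, hy, hxy, rfl⟩ := mem_colors.1 h1
      refine ⟨(x, y), fun _ => ⟨Finset.mem_sdiff.2 ⟨hx, fun h => h2 ?_⟩,
        Finset.mem_sdiff.2 ⟨hy, fun h => h2 ?_⟩, hxy, rfl⟩⟩
      · exact Finset.mem_biUnion.2 ⟨x, h, mem_colorsAt.2 ⟨y, hy, hxy.symm, rfl⟩⟩
      · exact Finset.mem_biUnion.2 ⟨y, h, mem_colorsAt.2 ⟨x, hx, hxy, hc _ _⟩⟩
    -- A dummy pair; only colors in `X` matter.
    · exact ⟨(v, v), fun h => absurd h hχ⟩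
  choose e he using hend
  have htr : IsTransversal c (fun χ => (e χ).1) (fun χ => (e χ).2) X (S \ W) := he
  have hXcard : (colors c S).card ≤ X.card + (p 0 + 1) * B := by
    have h1 := Finset.le_card_sdiff (W.biUnion (colorsAt c S)) (colors c S)
    have h2 : (W.biUnion (colorsAt c S)).card ≤ W.card * B :=
      Finset.card_biUnion_le_card_mul _ _ _ fun u hu => hB u (hWS hu)
    have h3 : W.card ≤ p 0 + 1 := hL ▸ Finset.card_insert_le v L
    have h4 := Nat.mul_le_mul_right B h3
    rw [← hX] at h1
    omega
  obtain ⟨U, C, hF, hU, hC⟩ := exists_rainbowForest_of_isTransversal hc (r := r) (M := S.card)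
    (D := D) t (p := fun i => p (i + 1)) htr hp (Finset.card_le_card Finset.sdiff_subset) (by
      intro u
      by_cases hu : u ∈ S
      · refine le_trans (Finset.card_le_card ?_) ((hB u hu).trans hBD)
        intro χ hχ
        obtain ⟨h1, h2⟩ := Finset.mem_filter.1 hχ
        obtain ⟨ha, hb, hab, hcol⟩ := he χ h1
        rcases h2 with h2 | h2
        · simp only at h2
          rw [h2] at hab hcol
          exact mem_colorsAt.2 ⟨_, (Finset.mem_sdiff.1 hb).1, hab.symm, hcol⟩
        · simp only at h2
          rw [h2] at hab hcol
          exact mem_colorsAt.2 ⟨_, (Finset.mem_sdiff.1 ha).1, hab, (hc _ _).trans hcol⟩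
      · have : incident (fun χ => (e χ).1) (fun χ => (e χ).2) X u = ∅ := by
          refine Finset.filter_eq_empty_iff.2 fun χ hχ h => hu ?_
          obtain ⟨ha, hb, -, -⟩ := he χ hχ
          rcases h with h | h
          · exact h ▸ (Finset.mem_sdiff.1 ha).1
          · exact h ▸ (Finset.mem_sdiff.1 hb).1
        rw [this]; simp) hD (by omega)
  have hUW : ∀ u ∈ W, u ∉ U := fun u hu h => (Finset.mem_sdiff.1 (hU h)).2 hu
  refine ⟨_, _, ⟨v, L, U, C, hF, fun h => by simpa using hLS h,
    hUW v (Finset.mem_insert_self _ _),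
    Finset.disjoint_left.2 fun x hx => hUW x (Finset.mem_insert_of_mem hx), hL, hinj, ?_, rfl, rfl⟩,
    Finset.insert_subset hv (Finset.union_subset (hLS.trans (Finset.erase_subset _ _))
      (hU.trans Finset.sdiff_subset))⟩
  rw [Finset.disjoint_left]
  intro χ hχ hχC
  obtain ⟨x, hx, rfl⟩ := Finset.mem_image.1 hχ
  have hx' := hLS hx
  exact (Finset.mem_sdiff.1 (hC hχC)).2 (Finset.mem_biUnion.2 ⟨v, Finset.mem_insert_self _ _,
    mem_colorsAt.2 ⟨x, Finset.mem_of_mem_erase hx', Finset.ne_of_mem_erase hx', rfl⟩⟩)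

/-! ### The exceptional pairs: two edges, and a two-edge star with an edge. -/

theorem rainbowForest_two {c : α → α → κ} {S : Finset α} {p : ℕ → ℕ} (hp : p 1 = 1)
    {v x y : α} {L : Finset α} (hv : v ∈ S) (hx : x ∈ S) (hy : y ∈ S) (hLS : L ⊆ S)
    (hL : L.card = p 0) (hvL : v ∉ L) (hvx : v ≠ x) (hvy : v ≠ y) (hxL : x ∉ L) (hyL : y ∉ L)
    (hxy : x ≠ y) (hinj : Set.InjOn (c v) L) (hcol : ∀ z ∈ L, c v z ≠ c x y) :
    ∃ U C, RainbowForest c 2 p U C ∧ U ⊆ S := by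
  refine ⟨_, _, ⟨v, L, {x, y}, {c x y}, ⟨x, {y}, ∅, ∅, ⟨rfl, rfl⟩, by simpa using hxy, by simp,
    by simp, by simp [hp], by simp, by simp, by simp, by simp⟩, hvL, ?_, ?_, hL, hinj, ?_, rfl,
    rfl⟩, ?_⟩
  · simp [hvx, hvy]
  · simp [hxL, hyL]
  · rw [Finset.disjoint_singleton_right]
    intro h
    obtain ⟨z, hz, e⟩ := Finset.mem_image.1 h
    exact hcol z hz e
  · intro z hz
    simp only [Finset.mem_insert, Finset.mem_union, Finset.mem_singleton] at hz
    rcases hz with rfl | hz | rfl | rfl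
    · exact hv
    · exact hLS hz
    · exact hx
    · exact hy

/-- Take two edges of different colors and an edge `xy` disjoint from both: `xy` differs in color
from at least one of them. -/
theorem exists_rainbowForest_one_one {c : α → α → κ} {S : Finset α}
    {p : ℕ → ℕ} (hp0 : p 0 = 1) (hp1 : p 1 = 1) (hS : 6 ≤ S.card) (hk : 1 < (colors c S).card) :
    ∃ U C, RainbowForest c 2 p U C ∧ U ⊆ S := by
  obtain ⟨χ, hχ, ψ, hψ, hne⟩ := Finset.one_lt_card.1 hk
  obtain ⟨a, ha, b, hb, hab, rfl⟩ := mem_colors.1 hχ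
  obtain ⟨d, hd, e, he, hde, rfl⟩ := mem_colors.1 hψ
  have h4 : ({a, b, d, e} : Finset α).card ≤ 4 := Finset.card_le_four
  have h1 := Finset.le_card_sdiff {a, b, d, e} S
  obtain ⟨x, hx, y, hy, hxy⟩ := Finset.one_lt_card.1 (show 1 < (S \ {a, b, d, e}).card by omega)
  simp only [Finset.mem_sdiff, Finset.mem_insert, Finset.mem_singleton, not_or] at hx hy
  have key : ∀ u w, u ∈ S → w ∈ S → u ≠ w → u ≠ x → u ≠ y → w ≠ x → w ≠ y → c u w ≠ c x y →
      ∃ U C, RainbowForest c 2 p U C ∧ U ⊆ S := by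
    intro u w hu hw huw hux huy hwx hwy hcol
    exact rainbowForest_two hp1 (L := {w}) hu hx.1 hy.1 (by simpa using hw) (by simp [hp0])
      (by simpa using huw) hux huy (by simpa using hwx.symm) (by simpa using hwy.symm) hxy (by simp)
      (by simpa using hcol)
  by_cases h : c a b = c x y
  · exact key d e hd he hde (by grind) (by grind) (by grind) (by grind) (fun h' => hne (h.trans h'.symm))
  · exact key a b ha hb hab (by grind) (by grind) (by grind) (by grind) h

/-- There is no rainbow path with two edges together with a disjoint edge inside `S`. -/
def NoRainbowPathEdge (c : α → α → κ) (S : Finset α) : Prop :=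
  ∀ u w z g h, u ∈ S → w ∈ S → z ∈ S → g ∈ S → h ∈ S → [u, w, z, g, h].Nodup →
    c u w ≠ c u z → c u w ≠ c g h → c u z ≠ c g h → False

/-- If `bx` had the color of `ab`, the path `y x b` with the edge `de` would be rainbow; if it had a
color other than those of `ab` and `de`, the path `a b x` with `de` would be. -/
theorem NoRainbowPathEdge.cross {c : α → α → κ} (hc : ∀ x y, c x y = c y x) {S : Finset α}
    (hno : NoRainbowPathEdge c S) {a b d e x y : α} (ha : a ∈ S) (hb : b ∈ S) (hd : d ∈ S)
    (he : e ∈ S) (hx : x ∈ S) (hy : y ∈ S) (hnd : [a, b, d, e, x, y].Nodup)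
    (h1 : c a b ≠ c d e) (h2 : c a b ≠ c x y) (h3 : c d e ≠ c x y) : c b x = c d e := by
  by_contra h
  by_cases h' : c b x = c a b
  · exact hno x y b d e hx hy hb hd he (by grind) (by grind) (by grind) (by grind)
  · exact hno b a x d e hb ha hx hd he (by grind) (by grind) (by grind) (by grind)

theorem NoRainbowPathEdge.not_disjoint {c : α → α → κ} (hc : ∀ x y, c x y = c y x) {S : Finset α}
    (hno : NoRainbowPathEdge c S) {a b d e x y : α} (ha : a ∈ S) (hb : b ∈ S) (hd : d ∈ S)
    (he : e ∈ S) (hx : x ∈ S) (hy : y ∈ S) (hnd : [a, b, d, e, x, y].Nodup)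
    (h1 : c a b ≠ c d e) (h2 : c a b ≠ c x y) (h3 : c d e ≠ c x y) : False := by
  have e1 := hno.cross hc he hd ha hb hx hy (by grind) (by grind) (by grind) (by grind)
  have e2 := hno.cross hc hb ha hd he hx hy (by grind) (by grind) (by grind) (by grind)
  have e3 := hno.cross hc ha hb hx hy he hd (by grind) (by grind) (by grind) (by grind)
  -- By the forced colors, `xd`, `xa` and `be` repeat the three colors of `ab`, `de` and `xy`.
  exact hno x d a b e hx hd ha hb he (by grind) (by grind) (by grind) (by grind)

theorem NoRainbowPathEdge.not_disjoint_pair {c : α → α → κ} (hc : ∀ x y, c x y = c y x)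
    {S : Finset α} (hno : NoRainbowPathEdge c S) {a b d e x y : α} (ha : a ∈ S) (hb : b ∈ S)
    (hd : d ∈ S) (he : e ∈ S) (hx : x ∈ S) (hy : y ∈ S) (hab : a ≠ b) (hde : d ≠ e) (hxy : x ≠ y)
    (hxn : x ∉ [a, b, d, e]) (hyn : y ∉ [a, b, d, e]) (h1 : c a b ≠ c d e)
    (h2 : c a b ≠ c x y) (h3 : c d e ≠ c x y) : False := by
  by_cases had : a = d
  · subst had
    exact hno a b e x y ha hb he hx hy (by grind) (by grind) (by grind) (by grind)
  by_cases hae : a = e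
  · subst hae
    exact hno a b d x y ha hb hd hx hy (by grind) (by grind) (by grind) (by grind)
  by_cases hbd : b = d
  · subst hbd
    exact hno b a e x y hb ha he hx hy (by grind) (by grind) (by grind) (by grind)
  by_cases hbe : b = e
  · subst hbe
    exact hno b a d x y hb ha hd hx hy (by grind) (by grind) (by grind) (by grind)
  exact hno.not_disjoint hc ha hb hd he hx hy (by grind) h1 h2 h3

/-- Edges of three different colors cover at most six vertices. An edge `xy` outside them repeats at
most one of the three colors, so the other two edges and `xy` have different colors. -/
theorem exists_rainbowForest_two_one {c : α → α → κ} (hc : ∀ x y, c x y = c y x) {S : Finset α}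
    {p : ℕ → ℕ} (hp0 : p 0 = 2) (hp1 : p 1 = 1) (hS : 8 ≤ S.card) (hk : 2 < (colors c S).card) :
    ∃ U C, RainbowForest c 2 p U C ∧ U ⊆ S := by
  by_contra hcon
  have hno : NoRainbowPathEdge c S := by
    intro u w z g h hu hw hz hg hh hnd h1 h2 h3
    simp only [List.nodup_cons, List.mem_cons, List.not_mem_nil, or_false, not_or] at hnd
    obtain ⟨⟨huw, huz, hug, huh⟩, ⟨hwz, hwg, hwh⟩, ⟨hzg, hzh⟩, hgh, -⟩ := hnd
    refine hcon (rainbowForest_two hp1 (L := {w, z}) hu hg hh ?_ ?_ ?_ hug huh ?_ ?_ hgh ?_ ?_)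
    · intro x hx
      rcases Finset.mem_insert.1 hx with rfl | hx
      · exact hw
      · rwa [Finset.mem_singleton.1 hx]
    · rw [Finset.card_pair hwz, hp0]
    · simp [huw, huz]
    · simp [Ne.symm hwg, Ne.symm hzg]
    · simp [Ne.symm hwh, Ne.symm hzh]
    · simp [h1]
    · simp [h2, h3]
  obtain ⟨χ₁, m₁, χ₂, m₂, χ₃, m₃, n₁, n₂, n₃⟩ := Finset.two_lt_card.1 hk
  obtain ⟨a₁, ha₁, b₁, hb₁, hab₁, rfl⟩ := mem_colors.1 m₁
  obtain ⟨a₂, ha₂, b₂, hb₂, hab₂, rfl⟩ := mem_colors.1 m₂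
  obtain ⟨a₃, ha₃, b₃, hb₃, hab₃, rfl⟩ := mem_colors.1 m₃
  have h6 : ({a₁, b₁, a₂, b₂, a₃, b₃} : Finset α).card ≤ 6 := Finset.card_le_six
  have h1 := Finset.le_card_sdiff {a₁, b₁, a₂, b₂, a₃, b₃} S
  obtain ⟨x, hx, y, hy, hxy⟩ := Finset.one_lt_card.1
    (show 1 < (S \ {a₁, b₁, a₂, b₂, a₃, b₃}).card by omega)
  simp only [Finset.mem_sdiff, Finset.mem_insert, Finset.mem_singleton, not_or] at hx hy
  by_cases e₁ : c a₁ b₁ = c x y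
  · exact hno.not_disjoint_pair hc ha₂ hb₂ ha₃ hb₃ hx.1 hy.1 hab₂ hab₃ hxy (by grind) (by grind)
      n₃ (by grind) (by grind)
  by_cases e₂ : c a₂ b₂ = c x y
  · exact hno.not_disjoint_pair hc ha₁ hb₁ ha₃ hb₃ hx.1 hy.1 hab₁ hab₃ hxy (by grind) (by grind)
      n₂ (by grind) (by grind)
  · exact hno.not_disjoint_pair hc ha₁ hb₁ ha₂ hb₂ hx.1 hy.1 hab₁ hab₂ hxy (by grind) (by grind)
      n₁ (by grind) (by grind)

end Coloring

/-! ### The upper bound for colorings of a finite set. -/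

section Coloring

variable {α κ : Type*} [DecidableEq α] [DecidableEq κ]

theorem three_mul_sq_le {t P m : ℕ} (h : 3 * (t + 1) ^ 2 * (P + 1) ^ 2 ≤ m) :
    3 * (P + 1) ^ 2 ≤ m :=
  le_trans (Nat.mul_le_mul_right _ (Nat.le_mul_of_pos_right _ (by positivity))) h

/-- The bounded degree case of the upper bound. -/
theorem exists_rainbowForest_of_bounded {c : α → α → κ} (hc : ∀ x y, c x y = c y x) {P : ℕ}
    {t : ℕ} {p : ℕ → ℕ} {S : Finset α} (ht : 1 ≤ t)
    (hanti : ∀ i j, i ≤ j → j < t + 1 → p j ≤ p i) (hpos : ∀ i < t + 1, 1 ≤ p i)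
    (hpP : p 0 ≤ P) (hS : 3 * (t + 1) ^ 2 * (P + 1) ^ 2 ≤ S.card)
    (hdeg : ∀ v ∈ S, (colorsAt c S v).card ≤ t * (2 * P + 1) + P)
    (h0 : 2 ≤ p 0 → (p 0 - 2) * S.card + 2 < 2 * (colors c S).card)
    (h1 : p 1 * S.card < 2 * (colors c S).card + p 1) :
    ∃ U C, RainbowForest c (t + 1) p U C ∧ U ⊆ S := by
  have hp0 := hpos 0 (by omega)
  have hp1 := hpos 1 (by omega)
  have h10 := hanti 0 1 (by omega) (by omega)
  have hS' := three_mul_sq_le hS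
  obtain ⟨v, hv, L, hLS, hL, hinj⟩ := exists_rainbow_star hc hp0 (S := S)
    (by nlinarith [Nat.mul_le_mul hpP hpP]) h0
  obtain ⟨r, hr⟩ := Nat.exists_eq_add_of_le' hp1
  obtain ⟨t, rfl⟩ := Nat.exists_eq_add_of_le' ht
  have hrP : r + 1 ≤ P := by omega
  -- With `r = p 1 - 1`, `h1` leaves a surplus of about `S.card` over `r * S.card`. It has to cover
  -- the losses `2 * t * D` and `2 * (p 0 + 1) * B`, both at most of order `t ^ 2 * (P + 1) ^ 2`.
  refine exists_rainbowForest_of_colorsAt_le hc (r := r) (D := (t + 1) * (P + 1) ^ 2)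
    (fun i hi => ?_) hdeg ?_ ?_ ?_ hv hLS hL hinj
  · rw [← hr]
    exact hanti 1 (i + 1) (by omega) (by omega)
  · nlinarith [Nat.zero_le (t * P)]
  · rw [mul_assoc, pow_two]
    exact Nat.mul_le_mul_left _ (Nat.mul_le_mul (by omega) (by omega))
  · rw [hr] at h1
    have hle : (p 0 + 1) * ((t + 1) * (2 * P + 1) + P) ≤
        (P + 1) * ((P + 1) * (2 * (t + 1) + 1)) := by
      gcongr
      nlinarith
    nlinarith [Nat.zero_le (t * P), sq_nonneg (P : ℤ), Nat.zero_le ((t + 2) ^ 2 * (P + 1) ^ 2)]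

/-- A coloring with more colors than each of the extremal ones has a rainbow star forest. -/
theorem exists_rainbowForest {c : α → α → κ} (hc : ∀ x y, c x y = c y x) {P : ℕ} (hP : 3 ≤ P)
    {t : ℕ} {p : ℕ → ℕ} {S : Finset α} (ht : 1 ≤ t)
    (hanti : ∀ i j, i ≤ j → j < t → p j ≤ p i) (hpos : ∀ i < t, 1 ≤ p i)
    (hpP : p 0 ≤ P) (hS : 3 * t ^ 2 * (P + 1) ^ 2 ≤ S.card)
    (h1 : ∀ i < t, 2 ≤ p i → 2 * (i : ℤ) * S.card - i * (i + 1) + (p i - 2) * (S.card - i) + 2 <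
      2 * (colors c S).card)
    (h2 : 2 ≤ t → 2 * ((t : ℤ) - 2) * S.card - (t - 1) * (t - 2) +
      2 * (if p (t - 2) = 1 then 1 else 2) < 2 * (colors c S).card) :
    ∃ U C, RainbowForest c t p U C ∧ U ⊆ S := by
  induction t generalizing p S with
  | zero => omega
  | succ t ih =>
    have hp0 := hpos 0 (by omega)
    have hS' := three_mul_sq_le hS
    have h1' : 2 ≤ p 0 → (p 0 - 2) * S.card + 2 < 2 * (colors c S).card := by
      intro h
      have := h1 0 (by omega) h
      obtain ⟨q, hq⟩ := Nat.exists_eq_add_of_le' h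
      rw [hq] at this ⊢
      rw [Nat.add_sub_cancel]
      zify
      push_cast at this
      linarith
    rcases Nat.eq_zero_or_pos t with rfl | htpos
    · obtain ⟨v, hv, L, hLS, hL, hinj⟩ := exists_rainbow_star hc hp0 (S := S)
        (by nlinarith [Nat.mul_le_mul hpP hpP]) h1'
      refine ⟨_, _, ⟨v, L, ∅, ∅, ⟨rfl, rfl⟩, fun h => by simpa using hLS h, by simp, by simp, hL,
        hinj, by simp, rfl, rfl⟩, ?_⟩
      exact Finset.insert_subset hv (by simpa using hLS.trans (Finset.erase_subset _ _))
    have hp1 := hpos 1 (by omega)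
    have h10 := hanti 0 1 (by omega) (by omega)
    -- The bound `P` stays fixed through the induction while the largest remaining star may shrink.
    by_cases hhigh : ∃ v ∈ S, t * (2 * P + 1) + P ≤ (colorsAt c S v).card
    · obtain ⟨v, hv, hvdeg⟩ := hhigh
      have hcard := Finset.card_erase_add_one hv
      have hk := card_colors_le_erase hc S v
      have hv1 := card_colorsAt_lt (c := c) hv
      have hcard' : (S.card : ℤ) = (S.erase v).card + 1 := by exact_mod_cast hcard.symm
      have hk' : (colors c S).card ≤ ((colors c (S.erase v)).card : ℤ) + (S.erase v).card := by
        zify at hk hv1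
        linarith
      obtain ⟨U, C, hF, hU⟩ := ih (p := fun i => p (i + 1)) (S := S.erase v) htpos
        (fun i j hij hj => hanti (i + 1) (j + 1) (by omega) (by omega))
        (fun i hi => hpos (i + 1) (by omega)) (h10.trans hpP) (by nlinarith)
        (fun i hi hpi => by
          have := h1 (i + 1) (by omega) hpi
          rw [hcard'] at this
          push_cast at this
          linarith)
        (fun ht2 => by
          have := h2 (by omega)
          rw [hcard', show t + 1 - 2 = t - 2 + 1 by omega] at this
          push_cast at this ⊢
          linarith)
      exact hF.cons_of_colorsAt (fun i hi => (hanti 0 i (by omega) hi).trans hpP) hv hU hvdeg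
    · push Not at hhigh
      have hS8 : 8 ≤ S.card := by nlinarith
      by_cases hspec : t = 1 ∧ p 0 ≤ 2 ∧ p 1 = 1
      · obtain ⟨rfl, h3, h4⟩ := hspec
        have h2' := h2 le_rfl
        simp only [Nat.reduceAdd, Nat.reduceSub] at h2'
        rcases (show p 0 = 1 ∨ p 0 = 2 by omega) with h5 | h5
        · rw [if_pos h5] at h2'
          refine exists_rainbowForest_one_one h5 h4 (by omega) ?_
          push_cast at h2'
          zify
          linarith
        · rw [if_neg (by omega)] at h2'
          refine exists_rainbowForest_two_one hc h5 h4 hS8 ?_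
          push_cast at h2'
          zify
          linarith
      refine exists_rainbowForest_of_bounded hc htpos hanti hpos hpP hS
        (fun v hv => (hhigh v hv).le) h1' ?_
      -- The count for the second star comes from `h1` at index `1` if `p 1 ≥ 2`. If `p 1 = 1`, it
      -- comes from `h1` at index `0` when `p 0 ≥ 3`, and otherwise from `h2`, where excluding the
      -- two special pairs forces at least three stars.
      rcases Nat.lt_or_ge (p 1) 2 with h3 | h3
      · have h4 : p 1 = 1 := by omega
        rw [h4]
        rcases Nat.lt_or_ge (p 0) 3 with h5 | h5
        · have ht2 : 2 ≤ t := by omega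
          have h6 := h2 (by omega)
          have h7 : (1 : ℤ) ≤ if p (t + 1 - 2) = 1 then 1 else 2 := by split_ifs <;> simp
          have h8 : (t : ℤ) ≤ S.card := by
            have : t ≤ S.card := by
              have := (Nat.le_mul_of_pos_right (3 * (t + 1) ^ 2)
                (show 0 < (P + 1) ^ 2 by positivity)).trans hS
              nlinarith
            exact_mod_cast this
          have h9 : (2 : ℤ) ≤ t := by exact_mod_cast ht2
          generalize (if p (t + 1 - 2) = 1 then (1 : ℤ) else 2) = R at h6 h7
          push_cast at h6
          zify
          nlinarith [mul_nonneg (sub_nonneg.2 h9) (show (0 : ℤ) ≤ 2 * S.card - t by linarith)]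
        · have := h1' (by omega)
          have : 1 * S.card ≤ (p 0 - 2) * S.card := Nat.mul_le_mul_right _ (by omega)
          omega
      · have := h1 1 (by omega) h3
        push_cast at this
        zify
        linarith

end Coloring

/-! ### From recursive rainbow forests to rainbow copies of `starForest`. -/

theorem starForest_adj {ι : Type*} {p : ι → ℕ} {x y : Σ i : ι, Fin 1 ⊕ Fin (p i)} :
    (starForest p).Adj x y ↔ ∃ (i : ι) (k : Fin (p i)),
      (x = ⟨i, Sum.inl 0⟩ ∧ y = ⟨i, Sum.inr k⟩) ∨ (x = ⟨i, Sum.inr k⟩ ∧ y = ⟨i, Sum.inl 0⟩) := by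
  simp only [starForest, SimpleGraph.iSup_adj, SimpleGraph.map_adj]
  constructor
  · rintro ⟨i, u, v, huv, rfl, rfl⟩
    rcases u with u | u <;> rcases v with v | v
    · simp at huv
    · exact ⟨i, v, Or.inl ⟨by rw [Subsingleton.elim u 0]; rfl, rfl⟩⟩
    · exact ⟨i, u, Or.inr ⟨rfl, by rw [Subsingleton.elim v 0]; rfl⟩⟩
    · simp at huv
  · rintro ⟨i, k, ⟨rfl, rfl⟩ | ⟨rfl, rfl⟩⟩
    · exact ⟨i, Sum.inl 0, Sum.inr k, by simp, rfl, rfl⟩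
    · exact ⟨i, Sum.inr k, Sum.inl 0, by simp, rfl, rfl⟩

theorem starForest_adj_center {ι : Type*} {p : ι → ℕ} (i : ι) (k : Fin (p i)) :
    (starForest p).Adj ⟨i, Sum.inl 0⟩ ⟨i, Sum.inr k⟩ :=
  starForest_adj.2 ⟨i, k, Or.inl ⟨rfl, rfl⟩⟩

theorem RainbowForest.exists_stars {α κ : Type*} [DecidableEq α] [DecidableEq κ] [Nonempty α]
    {c : α → α → κ} {t : ℕ} {p : ℕ → ℕ} {U : Finset α} {C : Finset κ}
    (h : RainbowForest c t p U C) :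
    ∃ (a : ℕ → α) (L : ℕ → Finset α),
      (∀ i < t, (L i).card = p i ∧ a i ∉ L i ∧ Set.InjOn (c (a i)) (L i) ∧ insert (a i) (L i) ⊆ U ∧
        (L i).image (c (a i)) ⊆ C) ∧
      ∀ i < t, ∀ j < t, i ≠ j → Disjoint (insert (a i) (L i)) (insert (a j) (L j)) ∧
        Disjoint ((L i).image (c (a i))) ((L j).image (c (a j))) := by
  induction t generalizing p U C with
  | zero => exact ⟨fun _ => Classical.arbitrary α, fun _ => ∅, by simp, by simp⟩
  | succ t ih =>
    obtain ⟨v, L₀, U', C', hF, hvL, hvU, hLU, hL, hinj, hC, rfl, rfl⟩ := h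
    obtain ⟨a, L, h1, h2⟩ := ih hF
    refine ⟨fun i => i.casesOn v a, fun i => i.casesOn L₀ L, ?_, ?_⟩
    · rintro (_ | i) hi
      · refine ⟨hL, hvL, hinj, ?_, Finset.subset_union_left⟩
        exact Finset.insert_subset_insert _ Finset.subset_union_left
      · obtain ⟨e1, e2, e3, e4, e5⟩ := h1 i (by omega)
        refine ⟨e1, e2, e3, e4.trans ?_, e5.trans Finset.subset_union_right⟩
        exact Finset.subset_union_right.trans (Finset.subset_insert _ _)
    · have h0 : Disjoint (insert v L₀) U' := Finset.disjoint_insert_left.2 ⟨hvU, hLU⟩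
      rintro (_ | i) hi (_ | j) hj hij
      · exact absurd rfl hij
      · obtain ⟨-, -, -, e4, e5⟩ := h1 j (by omega)
        exact ⟨Finset.disjoint_of_subset_right e4 h0, Finset.disjoint_of_subset_right e5 hC⟩
      · obtain ⟨-, -, -, e4, e5⟩ := h1 i (by omega)
        exact ⟨(Finset.disjoint_of_subset_right e4 h0).symm,
          (Finset.disjoint_of_subset_right e5 hC).symm⟩
      · exact h2 i (by omega) j (by omega) (by omega)

/-- An edge-labeling of the complete graph as a function of pairs of vertices. -/
def pairColor {V K : Type*} [DecidableEq V] (c : (⊤ : SimpleGraph V).EdgeLabeling K) (x y : V) :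
    Option K :=
  -- The value on the diagonal is irrelevant, as `colors` and `colorsAt` only use distinct vertices.
  if h : x ≠ y then some (c ⟨s(x, y), h⟩) else none

theorem pairColor_comm {V K : Type*} [DecidableEq V] (c : (⊤ : SimpleGraph V).EdgeLabeling K)
    (x y : V) : pairColor c x y = pairColor c y x := by
  by_cases h : x = y
  · rw [h]
  · have e : (⟨s(x, y), h⟩ : (⊤ : SimpleGraph V).edgeSet) = ⟨s(y, x), Ne.symm h⟩ :=
      Subtype.ext Sym2.eq_swap
    simp only [pairColor, ne_eq, h, Ne.symm h, not_false_eq_true, dite_true]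
    rw [e]

theorem card_le_card_colors_pairColor {n k : ℕ}
    {c : (⊤ : SimpleGraph (Fin n)).EdgeLabeling (Fin k)} (hc : Function.Surjective fun e => c e) :
    k ≤ (colors (pairColor c) Finset.univ).card := by
  have : (Finset.univ.image (some : Fin k → Option (Fin k))).card ≤
      (colors (pairColor c) Finset.univ).card := by
    apply Finset.card_le_card
    intro χ hχ
    obtain ⟨i, -, rfl⟩ := Finset.mem_image.1 hχ
    obtain ⟨⟨e, he⟩, rfl⟩ := hc i
    induction e using Sym2.ind with
    | _ x y =>
      have hxy : x ≠ y := he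
      exact mem_colors.2 ⟨x, Finset.mem_univ _, y, Finset.mem_univ _, hxy, by simp [pairColor, hxy]⟩
  rwa [Finset.card_image_of_injective _ (Option.some_injective _), Finset.card_univ,
    Fintype.card_fin] at this

/-- The recursion numbers stars from `0` and the theorem from `1`, hence the shifts `i + 1` and `i -
1`. Different stars have disjoint color sets, and within a star the color determines the leaf. -/
theorem RainbowForest.exists_isRainbowCopy {V K : Type*} [DecidableEq V] [DecidableEq K]
    [Nonempty V] {c : (⊤ : SimpleGraph V).EdgeLabeling K} {t : ℕ} {p : ℕ → ℕ} {U : Finset V}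
    {C : Finset (Option K)} (h : RainbowForest (pairColor c) t (fun i => p (i + 1)) U C) :
    ∃ f : (starForest fun i : Finset.Icc 1 t => p i).Copy (⊤ : SimpleGraph V),
      IsRainbowCopy c f := by
  obtain ⟨a, L, h1, h2⟩ := h.exists_stars
  have hlt : ∀ i : Finset.Icc 1 t, (i : ℕ) - 1 < t := fun i => by
    have := Finset.mem_Icc.1 i.2; omega
  have hcard : ∀ i : Finset.Icc 1 t, (L (i - 1)).card = p i := fun i => by
    have := Finset.mem_Icc.1 i.2
    rw [(h1 _ (hlt i)).1, Nat.sub_add_cancel this.1]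
  set leaf : ∀ i : Finset.Icc 1 t, Fin (p i) → V := fun i k =>
    ((L (i - 1)).equivFinOfCardEq (hcard i)).symm k with hleaf
  have leaf_mem : ∀ (i : Finset.Icc 1 t) (k : Fin (p i)), leaf i k ∈ L (i - 1) := fun i k => Subtype.prop _
  have leaf_inj : ∀ (i : Finset.Icc 1 t) (k k' : Fin (p i)), leaf i k = leaf i k' → k = k' := fun i k k' e =>
    (Equiv.injective _) (Subtype.ext e)
  have ne_leaf : ∀ (i : Finset.Icc 1 t) (k : Fin (p i)), a (i - 1) ≠ leaf i k := fun i k e =>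
    (h1 _ (hlt i)).2.1 (e ▸ leaf_mem i k)
  set φ : (Σ i : Finset.Icc 1 t, Fin 1 ⊕ Fin (p i)) → V := fun x =>
    Sum.elim (fun _ => a (x.1 - 1)) (leaf x.1) x.2 with hφ
  have φ_mem : ∀ x, φ x ∈ insert (a (x.1 - 1)) (L (x.1 - 1)) := by
    rintro ⟨i, u | u⟩
    · exact Finset.mem_insert_self _ _
    · exact Finset.mem_insert_of_mem (leaf_mem i u)
  have φ_inj : Function.Injective φ := by
    intro x y e
    have hxy : x.1 = y.1 := by
      by_contra hne
      have hne' : (x.1 : ℕ) - 1 ≠ y.1 - 1 := by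
        have h3 := Finset.mem_Icc.1 x.1.2
        have h4 := Finset.mem_Icc.1 y.1.2
        have h5 : (x.1 : ℕ) ≠ y.1 := fun h => hne (Subtype.ext h)
        omega
      exact Finset.disjoint_left.1 (h2 _ (hlt x.1) _ (hlt y.1) hne').1 (φ_mem x) (e ▸ φ_mem y)
    obtain ⟨i, u⟩ := x
    obtain ⟨j, v⟩ := y
    simp only at hxy
    subst hxy
    rcases u with u | u <;> rcases v with v | v
    · rw [Subsingleton.elim u v]
    · exact absurd e (ne_leaf i v)
    · exact absurd e.symm (ne_leaf i u)
    · rw [leaf_inj i u v e]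
  refine ⟨⟨⟨φ, fun {x y} hxy => φ_inj.ne hxy.ne⟩, φ_inj⟩, ?_⟩
  have hedge : ∀ e : (starForest fun i : Finset.Icc 1 t => p i).edgeSet,
      ∃ i k, e.1 = s(⟨i, Sum.inl 0⟩, ⟨i, Sum.inr k⟩) := by
    rintro ⟨e, he⟩
    induction e using Sym2.ind with
    | _ x y =>
      obtain ⟨i, k, ⟨rfl, rfl⟩ | ⟨rfl, rfl⟩⟩ := starForest_adj.1 he
      · exact ⟨i, k, rfl⟩
      · exact ⟨i, k, Sym2.eq_swap⟩
  intro e e' hee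
  obtain ⟨i, k, he⟩ := hedge e
  obtain ⟨j, l, he'⟩ := hedge e'
  have key : ∀ (i : Finset.Icc 1 t) (k : Fin (p i)) (he : s(⟨i, Sum.inl 0⟩, ⟨i, Sum.inr k⟩) ∈
      (starForest fun i : Finset.Icc 1 t => p i).edgeSet),
      some (c (SimpleGraph.Hom.mapEdgeSet ⟨φ, fun {x y} hxy => φ_inj.ne hxy.ne⟩ ⟨_, he⟩)) =
        pairColor c (a (i - 1)) (leaf i k) := by
    intro i k he
    simp only [pairColor, ne_eq, ne_leaf i k, not_false_eq_true, dite_true]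
    rfl
  obtain ⟨e, hmem⟩ := e
  obtain ⟨e', hmem'⟩ := e'
  simp only at he he'
  subst he he'
  have hcol : pairColor c (a (i - 1)) (leaf i k) = pairColor c (a (j - 1)) (leaf j l) := by
    rw [← key i k hmem, ← key j l hmem']
    exact congrArg some hee
  have hij : i = j := by
    by_contra hne
    have hne' : (i : ℕ) - 1 ≠ j - 1 := by
      have h3 := Finset.mem_Icc.1 i.2
      have h4 := Finset.mem_Icc.1 j.2
      have h5 : (i : ℕ) ≠ j := fun h => hne (Subtype.ext h)
      omega
    exact Finset.disjoint_left.1 (h2 _ (hlt i) _ (hlt j) hne').2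
      (Finset.mem_image_of_mem _ (leaf_mem i k)) (hcol ▸ Finset.mem_image_of_mem _ (leaf_mem j l))
  subst hij
  have := (h1 _ (hlt i)).2.2.1 (leaf_mem i k) (leaf_mem i l) hcol
  rw [Subtype.mk.injEq, leaf_inj i k l this]

/-! ### The extremal colorings. -/

/-- A near-regular graph of degree `d` on `{0, …, m - 1}`, given by its edges. -/
theorem exists_near_regular {d m : ℕ} (h : d + 2 ≤ m) :
    ∃ E : Finset (Sym2 ℕ), (∀ e ∈ E, ∃ x < m, ∃ y < m, x ≠ y ∧ e = s(x, y)) ∧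
      (∀ v, (E.filter (v ∈ ·)).card ≤ d) ∧ d * m ≤ 2 * E.card + 1 := by
  set w : ℕ × ℕ → ℕ := fun i => if i.1 + i.2 < m then i.1 + i.2 else i.1 + i.2 - m with hw
  -- A circulant graph: the pair `(x, r)` encodes the edge from `x` to `x + r` modulo `m`, with `1 ≤
  -- r ≤ d / 2`. For odd `d`, the set `J` adds a matching by the shift `m / 2`, which misses a
  -- vertex when `m` is odd.
  set g : ℕ × ℕ → Sym2 ℕ := fun i => s(i.1, w i) with hg
  set J : Finset (ℕ × ℕ) := if d % 2 = 1 then Finset.range (m / 2) ×ˢ {m / 2} else ∅ with hJ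
  set I : Finset (ℕ × ℕ) := Finset.range m ×ˢ Finset.Icc 1 (d / 2) ∪ J with hI
  have memJ : ∀ i ∈ J, d % 2 = 1 ∧ i.1 < m / 2 ∧ i.2 = m / 2 := by
    intro i hi
    rw [hJ] at hi
    split_ifs at hi with hd
    · obtain ⟨h1, h2⟩ := Finset.mem_product.1 hi
      exact ⟨hd, Finset.mem_range.1 h1, Finset.mem_singleton.1 h2⟩
    · simp at hi
  have memI : ∀ i ∈ I, (i.1 < m ∧ 1 ≤ i.2 ∧ i.2 ≤ d / 2) ∨
      (d % 2 = 1 ∧ i.1 < m / 2 ∧ i.2 = m / 2) := by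
    intro i hi
    rcases Finset.mem_union.1 hi with hi | hi
    · left; simpa using hi
    · right; exact memJ i hi
  have hdisj : Disjoint (Finset.range m ×ˢ Finset.Icc 1 (d / 2)) J := by
    rw [Finset.disjoint_left]
    intro i hi hi'
    have h1 : i.1 < m ∧ 1 ≤ i.2 ∧ i.2 ≤ d / 2 := by simpa using hi
    have h2 := memJ i hi'
    omega
  have ginj : Set.InjOn g I := by
    rintro ⟨j, r⟩ hi ⟨j', r'⟩ hi' e
    have h1 := memI _ hi
    have h2 := memI _ hi'
    simp only [hg, hw, Sym2.eq_iff] at e h1 h2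
    rw [Prod.mk.injEq]
    split_ifs at e <;> omega
  refine ⟨I.image g, ?_, ?_, ?_⟩
  · intro e he
    obtain ⟨⟨j, r⟩, hi, rfl⟩ := Finset.mem_image.1 he
    have h1 := memI _ hi
    simp only at h1
    refine ⟨j, by omega, w (j, r), ?_, ?_, rfl⟩ <;> simp only [hw] <;> split_ifs <;> omega
  · intro v
    -- `A` encodes the edges leaving `v`, `B` those arriving at `v`, and `D` a possible matching
    -- edge.
    set A := (Finset.Icc 1 (d / 2)).image fun r => (v, r) with hA
    set B := (Finset.Icc 1 (d / 2)).image fun r => (if r ≤ v then v - r else v + m - r, r) with hB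
    set D : Finset (ℕ × ℕ) := if d % 2 = 1 then
      {if v < m / 2 then (v, m / 2) else (v - m / 2, m / 2)} else ∅ with hD
    have hsub : (I.image g).filter (v ∈ ·) ⊆ (A ∪ B ∪ D).image g := by
      intro e he
      obtain ⟨he, hv⟩ := Finset.mem_filter.1 he
      obtain ⟨⟨j, r⟩, hi, rfl⟩ := Finset.mem_image.1 he
      refine Finset.mem_image_of_mem g ?_
      have h1 := memI _ hi
      simp only [hg, hw, Sym2.mem_iff] at hv h1
      rw [Finset.mem_union, Finset.mem_union]
      rcases h1 with h1 | h1
      · left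
        rcases hv with rfl | hv
        · left; exact Finset.mem_image.2 ⟨r, Finset.mem_Icc.2 h1.2, rfl⟩
        · right
          refine Finset.mem_image.2 ⟨r, Finset.mem_Icc.2 h1.2, ?_⟩
          rw [Prod.mk.injEq]
          split_ifs at hv ⊢ <;> omega
      · right
        rw [hD, if_pos h1.1, Finset.mem_singleton]
        split_ifs at hv ⊢ <;> rw [Prod.mk.injEq] <;> omega
    have h1 : A.card ≤ d / 2 := Finset.card_image_le.trans (by simp)
    have h2 : B.card ≤ d / 2 := Finset.card_image_le.trans (by simp)
    have h3 : D.card ≤ d % 2 := by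
      rw [hD]
      split_ifs with hd <;> simp [hd]
    have h4 := Finset.card_union_le (A ∪ B) D
    have h5 := Finset.card_union_le A B
    have h6 := Finset.card_le_card hsub
    have h7 : ((A ∪ B ∪ D).image g).card ≤ (A ∪ B ∪ D).card := Finset.card_image_le
    omega
  · rw [Finset.card_image_of_injOn ginj, hI, Finset.card_union_of_disjoint hdisj]
    have h1 : J.card = d % 2 * (m / 2) := by
      rw [hJ]
      split_ifs with hd
      · simp [hd]
      · rw [show d % 2 = 0 by omega]; simp
    rw [h1, Finset.card_product, Finset.card_range, Nat.card_Icc, Nat.add_sub_cancel]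
    have h2 : d = 2 * (d / 2) + d % 2 := (Nat.div_add_mod d 2).symm
    rcases Nat.mod_two_eq_zero_or_one d with h3 | h3 <;> rw [h3] at h2 ⊢
    · nlinarith
    · have : m ≤ 2 * (m / 2) + 1 := by omega
      nlinarith

theorem bddAbove_antiRamseySet {W : Type*} (n : ℕ) (F : SimpleGraph W) :
    BddAbove (antiRamseySet n F) := by
  refine ⟨Nat.card (⊤ : SimpleGraph (Fin n)).edgeSet, ?_⟩
  rintro k ⟨c, hc, -⟩
  simpa using Nat.card_le_card_of_surjective _ hc

/-- The colors of a coloring without rainbow copies bound the anti-Ramsey number from below. -/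
theorem card_le_antiRamsey {W K : Type*} {n : ℕ} {F : SimpleGraph W}
    {c : (⊤ : SimpleGraph (Fin n)).EdgeLabeling K}
    (h : ∀ f : F.Copy (⊤ : SimpleGraph (Fin n)), ¬ IsRainbowCopy c f) {Y : Finset K}
    (hY : ∀ χ ∈ Y, ∃ e, c e = χ) :
    (antiRamseySet n F).Nonempty ∧ Y.card ≤ antiRamsey n F := by
  have hfin : (Set.range fun e => c e).Finite := Set.finite_range _
  have : Finite (Set.range fun e => c e) := hfin
  -- Only colors that occur are numbered, which makes the renumbered coloring surjective.
  have eq := Finite.equivFin (Set.range fun e => c e)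
  have hmem : Nat.card (Set.range fun e => c e) ∈ antiRamseySet n F := by
    refine ⟨fun e => eq ⟨c e, e, rfl⟩, ?_, ?_⟩
    · intro i
      obtain ⟨e, he⟩ := (eq.symm i).2
      refine ⟨e, ?_⟩
      rw [← eq.apply_symm_apply i]
      exact congrArg eq (Subtype.ext he)
    · intro f hf
      refine h f fun e e' hee => hf ?_
      exact congrArg eq (Subtype.ext hee)
  refine ⟨⟨_, hmem⟩, le_trans ?_ (le_csSup (bddAbove_antiRamseySet n F) hmem)⟩
  rw [Nat.card_coe_set_eq, ← Set.ncard_coe_finset]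
  exact Set.ncard_le_ncard (fun χ hχ => hY χ hχ) hfin

/-- The edges of `E` and the edges that meet `{m, m + 1, …}` get pairwise different colors, all
other edges get the color `none`. -/
noncomputable def extremalColoring (n m : ℕ) (E : Finset (Sym2 ℕ)) :
    (⊤ : SimpleGraph (Fin n)).EdgeLabeling (Option (Sym2 ℕ)) :=
  open Classical in
  fun e => if (∃ x ∈ e.1.map Fin.val, m ≤ x) ∨ e.1.map Fin.val ∈ E then some (e.1.map Fin.val)
    else none

theorem extremalColoring_of_lt {n m : ℕ} {E : Finset (Sym2 ℕ)} {x y : Fin n} (hx : (x : ℕ) < m)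
    (hy : (y : ℕ) < m) (hxy : s(x, y) ∈ (⊤ : SimpleGraph (Fin n)).edgeSet) :
    extremalColoring n m E ⟨s(x, y), hxy⟩ =
      if s((x : ℕ), (y : ℕ)) ∈ E then some s((x : ℕ), (y : ℕ)) else none := by
  simp [extremalColoring, not_le.2 hx, not_le.2 hy]

theorem two_mul_sum_Ico {m n : ℕ} (h : m ≤ n) :
    2 * ((∑ y ∈ Finset.Ico m n, y : ℕ) : ℤ) = n * (n - 1) - m * (m - 1) := by
  induction n, h using Nat.le_induction with
  | base => simp
  | succ n hmn ih =>
    rw [Finset.sum_Ico_succ_top hmn]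
    push_cast at ih ⊢
    linarith

/-- The colors of `extremalColoring` bound the anti-Ramsey number from below. -/
theorem le_antiRamsey_of_extremalColoring {W : Type*} {n m : ℕ} {F : SimpleGraph W}
    {E : Finset (Sym2 ℕ)} (hmn : m ≤ n)
    (hE : ∀ e ∈ E, ∃ x < m, ∃ y < m, x ≠ y ∧ e = s(x, y))
    (hnone : ∃ x < m, ∃ y < m, x ≠ y ∧ s(x, y) ∉ E)
    (h : ∀ f : F.Copy (⊤ : SimpleGraph (Fin n)), ¬ IsRainbowCopy (extremalColoring n m E) f) :
    (antiRamseySet n F).Nonempty ∧ (n : ℤ) * (n - 1) - m * (m - 1) + 2 * E.card + 2 ≤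
      2 * (antiRamsey n F : ℤ) := by
  classical
  -- The edges meeting `{m, …, n - 1}`, sorted by their larger end `y`.
  set A : Finset (Sym2 ℕ) := ((Finset.Ico m n).sigma fun y => Finset.range y).image
    fun z => s(z.2, z.1) with hA
  have hAcard : A.card = ∑ y ∈ Finset.Ico m n, y := by
    rw [hA, Finset.card_image_of_injOn, Finset.card_sigma]
    · simp
    · rintro ⟨y, x⟩ h1 ⟨y', x'⟩ h2 e
      simp only [Finset.coe_sigma, Set.mem_sigma_iff, Finset.mem_coe, Finset.mem_range] at h1 h2
      simp only [Sym2.eq_iff] at e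
      have : y = y' ∧ x = x' := by omega
      rw [this.1, this.2]
  have hdisj : Disjoint A E := by
    rw [Finset.disjoint_left]
    intro e he he'
    obtain ⟨⟨y, x⟩, hyx, rfl⟩ := Finset.mem_image.1 he
    obtain ⟨u, hu, v, hv, -, huv⟩ := hE _ he'
    simp only [Finset.mem_sigma, Finset.mem_Ico] at hyx
    simp only [Sym2.eq_iff] at huv
    omega
  have hval : ∀ {x y : ℕ} (hx : x < n) (hy : y < n) (hxy : x ≠ y),
      extremalColoring n m E ⟨s(⟨x, hx⟩, ⟨y, hy⟩), fun e => hxy (congrArg Fin.val e)⟩ =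
        if (∃ z ∈ s(x, y), m ≤ z) ∨ s(x, y) ∈ E then some s(x, y) else none := fun hx hy hxy => by
    simp [extremalColoring]
  obtain ⟨hne, hle⟩ := card_le_antiRamsey h (Y := insert none ((A ∪ E).image some)) (by
    intro χ hχ
    rcases Finset.mem_insert.1 hχ with rfl | hχ
    · obtain ⟨x, hx, y, hy, hxy, hn⟩ := hnone
      refine ⟨_, (hval (hx.trans_le hmn) (hy.trans_le hmn) hxy).trans (if_neg ?_)⟩
      rintro (⟨z, hz, hmz⟩ | h)
      · rcases Sym2.mem_iff.1 hz with rfl | rfl <;> omega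
      · exact hn h
    · obtain ⟨e, he, rfl⟩ := Finset.mem_image.1 hχ
      rcases Finset.mem_union.1 he with he | he
      · obtain ⟨⟨y, x⟩, hyx, rfl⟩ := Finset.mem_image.1 he
        simp only [Finset.mem_sigma, Finset.mem_Ico, Finset.mem_range] at hyx
        refine ⟨_, (hval (x := x) (y := y) (by omega) (by omega) (by omega)).trans
          (if_pos (Or.inl ⟨y, Sym2.mem_mk_right _ _, hyx.1.1⟩))⟩
      · obtain ⟨x, hx, y, hy, hxy, rfl⟩ := hE e he
        exact ⟨_, (hval (hx.trans_le hmn) (hy.trans_le hmn) hxy).trans (if_pos (Or.inr he))⟩)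
  refine ⟨hne, ?_⟩
  rw [Finset.card_insert_of_notMem (by simp), Finset.card_image_of_injective _
    (Option.some_injective _), Finset.card_union_of_disjoint hdisj, hAcard] at hle
  rw [← two_mul_sum_Ico hmn]
  zify at hle
  push_cast
  linarith

section Copy

variable {ι : Type*} {p : ι → ℕ} {n : ℕ}

/-- Some star of a copy avoids a set of vertices that is smaller than the number of stars. -/
theorem exists_star_lt (f : (starForest p).Copy (⊤ : SimpleGraph (Fin n))) {m : ℕ}
    {T : Finset ι} (hT : n - m < T.card) :
    ∃ i ∈ T, ∀ u, (f.toHom ⟨i, u⟩ : ℕ) < m := by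
  by_contra! hbad
  choose g hg using hbad
  have : T.card ≤ (Finset.Ico m n).card := by
    rw [← Finset.card_attach]
    refine Finset.card_le_card_of_injOn (fun i => (f.toHom ⟨i.1, g i.1 i.2⟩ : ℕ)) ?_ ?_
    · intro i _
      exact Finset.mem_coe.2 (Finset.mem_Ico.2 ⟨hg _ _, Fin.is_lt _⟩)
    · intro i _ j _ hij
      have := f.injective (Fin.ext hij)
      exact Subtype.ext (Sigma.mk.inj this).1
  simp at this
  omega

theorem IsRainbowCopy.injective {K : Type*} {c : (⊤ : SimpleGraph (Fin n)).EdgeLabeling K}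
    {f : (starForest p).Copy (⊤ : SimpleGraph (Fin n))} (h : IsRainbowCopy c f) :
    Function.Injective fun x : Σ i, Fin (p i) =>
      c ⟨s(f.toHom ⟨x.1, Sum.inl 0⟩, f.toHom ⟨x.1, Sum.inr x.2⟩),
        f.toHom.map_adj (starForest_adj_center x.1 x.2)⟩ := by
  rintro ⟨i, k⟩ ⟨j, l⟩ e
  have := h (a₁ := ⟨s(⟨i, Sum.inl 0⟩, ⟨i, Sum.inr k⟩), starForest_adj_center i k⟩)
    (a₂ := ⟨s(⟨j, Sum.inl 0⟩, ⟨j, Sum.inr l⟩), starForest_adj_center j l⟩) e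
  replace this := congrArg Subtype.val this
  simp only [Sym2.eq_iff, Sigma.mk.injEq] at this
  rcases this with ⟨-, h1, h2⟩ | ⟨⟨h1, h2⟩, -⟩
  · subst h1
    simpa using h2
  · subst h1
    simp at h2

/-- A star of a rainbow copy that avoids `{m, m + 1, …}` is at most one larger than the maximum
degree of `E`. -/
theorem card_star_le {m d : ℕ} {E : Finset (Sym2 ℕ)} (hE : ∀ v, (E.filter (v ∈ ·)).card ≤ d)
    {f : (starForest p).Copy (⊤ : SimpleGraph (Fin n))}
    (h : IsRainbowCopy (extremalColoring n m E) f) {i : ι}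
    (hi : ∀ u, (f.toHom ⟨i, u⟩ : ℕ) < m) : p i ≤ d + 1 := by
  set v : ℕ := ((f.toHom ⟨i, Sum.inl 0⟩ : Fin n) : ℕ) with hv
  -- The star can use the colors of the `E`-edges at its center, and `none` once.
  have hcard : (insert none ((E.filter (v ∈ ·)).image some)).card ≤ d + 1 :=
    (Finset.card_insert_le _ _).trans
      (Nat.add_le_add_right (Finset.card_image_le.trans (hE v)) 1)
  refine le_trans ?_ hcard
  rw [← Fintype.card_fin (p i), ← Finset.card_univ]
  refine Finset.card_le_card_of_injOn (fun k => extremalColoring n m E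
    ⟨s(f.toHom ⟨i, Sum.inl 0⟩, f.toHom ⟨i, Sum.inr k⟩),
      f.toHom.map_adj (starForest_adj_center i k)⟩) ?_ ?_
  · intro k _
    refine Set.mem_of_eq_of_mem (extremalColoring_of_lt (hi _) (hi _) _) ?_
    split_ifs with hk
    · exact Finset.mem_coe.2 (Finset.mem_insert_of_mem (Finset.mem_image_of_mem _
        (Finset.mem_filter.2 ⟨hk, Sym2.mem_mk_left _ _⟩)))
    · exact Finset.mem_coe.2 (Finset.mem_insert_self _ _)
  · intro k _ l _ hkl
    have := h.injective (a₁ := ⟨i, k⟩) (a₂ := ⟨i, l⟩) hkl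
    simpa using this

/-- Two stars of a rainbow copy that avoid `{m, m + 1, …}` have at most `#E + 1` edges. -/
theorem card_star_add_card_star_le {m : ℕ} {E : Finset (Sym2 ℕ)}
    {f : (starForest p).Copy (⊤ : SimpleGraph (Fin n))}
    (h : IsRainbowCopy (extremalColoring n m E) f) {i j : ι} (hij : i ≠ j)
    (hi : ∀ u, (f.toHom ⟨i, u⟩ : ℕ) < m) (hj : ∀ u, (f.toHom ⟨j, u⟩ : ℕ) < m) :
    p i + p j ≤ E.card + 1 := by
  classical
  have hcard : (insert none (E.image some)).card ≤ E.card + 1 :=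
    (Finset.card_insert_le _ _).trans (Nat.add_le_add_right Finset.card_image_le 1)
  have hsum : (({i, j} : Finset ι).sigma fun i => (Finset.univ : Finset (Fin (p i)))).card =
      p i + p j := by
    rw [Finset.card_sigma, Finset.sum_pair hij]
    simp
  rw [← hsum]
  refine le_trans (Finset.card_le_card_of_injOn _ ?_ h.injective.injOn) hcard
  rintro ⟨l, k⟩ hl
  have hlt : ∀ u, (f.toHom ⟨l, u⟩ : ℕ) < m := by
    have hl' := (Finset.mem_sigma.1 (Finset.mem_coe.1 hl)).1
    simp only [Finset.mem_insert, Finset.mem_singleton] at hl'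
    rcases hl' with rfl | rfl
    · exact hi
    · exact hj
  refine Set.mem_of_eq_of_mem (extremalColoring_of_lt (hlt _) (hlt _) _) ?_
  split_ifs with hk
  · exact Finset.mem_coe.2 (Finset.mem_insert_of_mem (Finset.mem_image_of_mem _ hk))
  · exact Finset.mem_coe.2 (Finset.mem_insert_self _ _)

end Copy

/-! ### The two families of lower bounds, and the theorem. -/

theorem two_mul_choose_two (i : ℕ) : 2 * ((i.choose 2 : ℕ) : ℤ) = i * (i - 1) := by
  have : ((2 * ((i.choose 2 : ℕ) : ℤ) : ℤ) : ℚ) = ((i * (i - 1) : ℤ) : ℚ) := by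
    push_cast
    rw [Nat.cast_choose_two]
    ring
  exact_mod_cast this

theorem floor_half_mul {a b : ℤ} : ⌊((a : ℚ)) / 2 * b⌋ = a * b / 2 := by
  rw [show ((a : ℚ)) / 2 * b = ((a * b : ℤ) : ℚ) / ((2 : ℕ) : ℚ) by push_cast; ring,
    Rat.floor_intCast_div_natCast]
  simp

theorem exists_lt_of_sparse {d m : ℕ} {E : Finset (Sym2 ℕ)} (h : d + 2 ≤ m)
    (hE : ∀ v, (E.filter (v ∈ ·)).card ≤ d) : ∃ x < m, ∃ y < m, x ≠ y ∧ s(x, y) ∉ E := by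
  by_contra! hall
  have h1 : ((Finset.Ico 1 m).image fun y => s(0, y)).card = m - 1 := by
    rw [Finset.card_image_of_injective, Nat.card_Ico]
    intro y y' e
    have : y = y' ∨ 0 = y' ∧ y = 0 := by simpa using e
    omega
  have h2 : ((Finset.Ico 1 m).image fun y => s(0, y)) ⊆ E.filter (0 ∈ ·) := by
    intro e he
    obtain ⟨y, hy, rfl⟩ := Finset.mem_image.1 he
    have := Finset.mem_Ico.1 hy
    exact Finset.mem_filter.2 ⟨hall 0 (by omega) y (by omega) (by omega), Sym2.mem_mk_left _ _⟩
  have := Finset.card_le_card h2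
  have := hE 0
  omega

/-- With `m = n - (i - 1)`, one of the stars `1, …, i` lies below `m`. It has at least `p i` edges,
while `E` of degree `d = p i - 2` allows only `d + 1`. -/
theorem le_antiRamsey_of_near_regular {t i n : ℕ} {p : ℕ → ℕ}
    (hanti : ∀ i j : ℕ, 1 ≤ i → i ≤ j → j ≤ t → p j ≤ p i) (hi : 1 ≤ i) (hit : i ≤ t)
    (hpi : 2 ≤ p i) (hn : p i + i ≤ n) :
    (antiRamseySet n (starForest fun i : Finset.Icc 1 t => p i)).Nonempty ∧
    ((i : ℤ) - 1) * n - (i.choose 2 : ℤ) + ((p i : ℤ) - 2) * (n - i + 1) / 2 + 1 ≤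
      antiRamsey n (starForest fun i : Finset.Icc 1 t => p i) := by
  obtain ⟨d, hd⟩ := Nat.exists_eq_add_of_le' hpi
  obtain ⟨m, hm⟩ := Nat.exists_eq_add_of_le (show i - 1 ≤ n by omega)
  obtain ⟨E, hE, hdeg, hcard⟩ := exists_near_regular (d := d) (m := m) (by omega)
  obtain ⟨hne, hle⟩ := le_antiRamsey_of_extremalColoring
    (F := starForest fun i : Finset.Icc 1 t => p i) (show m ≤ n by omega) hE
    (exists_lt_of_sparse (by omega) hdeg) (by
      intro f hf
      obtain ⟨j, hj, hlt⟩ := exists_star_lt f (m := m)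
        (T := (Finset.Icc 1 i).subtype (· ∈ Finset.Icc 1 t)) (by
          rw [Finset.card_subtype, Finset.filter_true_of_mem, Nat.card_Icc]
          · omega
          · intro j hj
            rw [Finset.mem_Icc] at hj ⊢
            omega)
      have h1 := card_star_le hdeg hf hlt
      have h2 := Finset.mem_Icc.1 (Finset.mem_subtype.1 hj)
      have h3 := hanti j i h2.1 h2.2 hit
      omega)
  refine ⟨hne, ?_⟩
  have h1 : (n : ℤ) = i - 1 + m := by omega
  have h2 := two_mul_choose_two i
  have h3 : ((p i : ℤ) - 2) * (n - i + 1) / 2 ≤ E.card := by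
    have h4 : ((p i : ℤ) - 2) * (n - i + 1) = ((d * m : ℕ) : ℤ) := by
      rw [hd, h1]; push_cast; ring
    rw [h4]
    omega
  generalize ((p i : ℤ) - 2) * (n - i + 1) / 2 = q at h3 ⊢
  rw [h1] at hle ⊢
  nlinarith

/-- With `m = n - (t - 2)`, two stars lie below `m`, where only `E.card + 1` colors occur. Two stars
have at least two edges, and at least three if `p (t - 1) ≥ 2`, since one of them has index at most
`t - 1`. -/
theorem le_antiRamsey_of_two_stars {t n : ℕ} {p : ℕ → ℕ} (ht : 2 ≤ t) (hn : t + 2 ≤ n)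
    (hanti : ∀ i j : ℕ, 1 ≤ i → i ≤ j → j ≤ t → p j ≤ p i)
    (hpos : ∀ i : ℕ, 1 ≤ i → i ≤ t → 1 ≤ p i) :
    ((t : ℤ) - 2) * n - ((t - 1).choose 2 : ℤ) + (if p (t - 1) = 1 then 1 else 2) ≤
      antiRamsey n (starForest fun i : Finset.Icc 1 t => p i) := by
  obtain ⟨m, hm⟩ := Nat.exists_eq_add_of_le (show t - 2 ≤ n by omega)
  obtain ⟨E, hEsub, hEcard⟩ : ∃ E : Finset (Sym2 ℕ), E ⊆ {s(0, 1)} ∧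
      E.card + 1 = if p (t - 1) = 1 then 1 else 2 := by
    split_ifs
    · exact ⟨∅, by simp, rfl⟩
    · exact ⟨{s(0, 1)}, by simp, by simp⟩
  obtain ⟨-, hle⟩ := le_antiRamsey_of_extremalColoring
    (F := starForest fun i : Finset.Icc 1 t => p i) (E := E) (show m ≤ n by omega)
    (fun e he => ⟨0, by omega, 1, by omega, by omega, by simpa using hEsub he⟩)
    ⟨1, by omega, 2, by omega, by omega, fun h => by simpa using hEsub h⟩ (by
      intro f hf
      have hT : (Finset.univ : Finset (Finset.Icc 1 t)).card = t := by simp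
      obtain ⟨i, hi, hilt⟩ := exists_star_lt f (m := m) (T := Finset.univ) (by omega)
      obtain ⟨j, hj, hjlt⟩ := exists_star_lt f (m := m) (T := Finset.univ.erase i) (by
        rw [Finset.card_erase_of_mem hi]
        omega)
      have hji := Finset.ne_of_mem_erase hj
      have h1 := card_star_add_card_star_le hf hji.symm hilt hjlt
      have h2 := Finset.mem_Icc.1 i.2
      have h3 := Finset.mem_Icc.1 j.2
      have h4 := hpos i h2.1 h2.2
      have h5 := hpos j h3.1 h3.2
      rw [hEcard] at h1
      split_ifs at h1 with h
      · omega
      · have h6 := hpos (t - 1) (by omega) (by omega)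
        have h7 : (i : ℕ) ≠ j := fun e => hji (Subtype.ext e.symm)
        rcases (show (i : ℕ) ≤ t - 1 ∨ (j : ℕ) ≤ t - 1 by omega) with h8 | h8
        · have := hanti i (t - 1) h2.1 h8 (by omega)
          omega
        · have := hanti j (t - 1) h3.1 h8 (by omega)
          omega)
  have h1 : (n : ℤ) = t - 2 + m := by omega
  have h2 := two_mul_choose_two (t - 1)
  rw [Nat.cast_sub (by omega)] at h2
  have h3 : (if p (t - 1) = 1 then 1 else 2 : ℤ) = E.card + 1 := by
    split_ifs at hEcard ⊢ <;> omega
  rw [h3]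
  push_cast at h2
  rw [h1] at hle ⊢
  nlinarith

theorem theorem8 (t : ℕ) (p : ℕ → ℕ) (ht : 1 ≤ t)
    (hp₁ : 3 ≤ p 1)
    (hanti : ∀ i j : ℕ, 1 ≤ i → i ≤ j → j ≤ t → p j ≤ p i)
    (hpos : ∀ i : ℕ, 1 ≤ i → i ≤ t → 1 ≤ p i)
    (s : ℕ) (hs : IsGreatest {i : ℕ | 1 ≤ i ∧ i ≤ t ∧ 2 ≤ p i} s)
    (n : ℕ) (hn : 3 * t ^ 2 * (p 1 + 1) ^ 2 ≤ n) :
    (antiRamsey n (starForest fun i : Finset.Icc 1 t => p i) : ℤ) =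
      max
        ((Finset.Icc 1 s).sup' (Finset.nonempty_Icc.mpr hs.1.1) fun i : ℕ =>
          ((i : ℤ) - 1) * n - (i.choose 2 : ℤ)
            + ⌊((p i : ℚ) - 2) / 2 * ((n : ℚ) - i + 1)⌋ + 1)
        (((t : ℤ) - 2) * n - ((t - 1).choose 2 : ℤ) + (if p (t - 1) = 1 then 1 else 2)) := by
  have hfloor : ∀ i : ℕ, ⌊((p i : ℚ) - 2) / 2 * ((n : ℚ) - i + 1)⌋ =
      ((p i : ℤ) - 2) * (n - i + 1) / 2 := by
    intro i
    rw [← floor_half_mul]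
    push_cast
    rfl
  simp only [hfloor]
  have hbig : p 1 + t + 2 ≤ n := by
    obtain ⟨u, rfl⟩ := Nat.exists_eq_add_of_le' ht
    nlinarith [Nat.zero_le (u * p 1), Nat.zero_le (u ^ 2 * (p 1 + 1) ^ 2),
      Nat.zero_le (u * (p 1 + 1) ^ 2)]
  have hlow : ∀ i, 1 ≤ i → i ≤ s → _ := fun i hi his =>
    le_antiRamsey_of_near_regular (n := n) hanti hi (his.trans hs.1.2.1)
      (hs.1.2.2.trans (hanti i s hi his hs.1.2.1)) (by
        have := hanti 1 i le_rfl hi (his.trans hs.1.2.1)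
        have := hs.1.2.1
        omega)
  apply le_antisymm
  · by_contra! hlt
    -- The lower-bound coloring also shows that the set is nonempty, so the supremum is attained by
    -- a coloring.
    have hmem := (isGreatest_antiRamsey n _ (hlow 1 le_rfl hs.1.1).1).1
    generalize antiRamsey n (starForest fun i : Finset.Icc 1 t => p i) = k at hmem hlt
    obtain ⟨c, hc, hno⟩ := hmem
    obtain ⟨hlt₁, hlt₂⟩ := max_lt_iff.1 hlt
    rw [Finset.sup'_lt_iff] at hlt₁
    have : Nonempty (Fin n) := ⟨⟨0, by omega⟩⟩
    have hk : (k : ℤ) ≤ (colors (pairColor c) Finset.univ).card := by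
      exact_mod_cast card_le_card_colors_pairColor hc
    obtain ⟨U, C, hF, -⟩ := exists_rainbowForest (pairColor_comm c) hp₁ (t := t)
      (p := fun i => p (i + 1)) (S := Finset.univ) ht
      (fun i j hij hj => hanti (i + 1) (j + 1) (by omega) (by omega) (by omega))
      (fun i hi => hpos (i + 1) (by omega) (by omega)) le_rfl (by simpa using hn)
      (by
        intro i hi hpi
        have h1 := hlt₁ (i + 1) (Finset.mem_Icc.2 ⟨by omega, hs.2 ⟨by omega, by omega, hpi⟩⟩)
        have h2 := two_mul_choose_two (i + 1)
        rw [Finset.card_univ, Fintype.card_fin]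
        have e : ((p (i + 1) : ℤ) - 2) * (n - ((i + 1 : ℕ) : ℤ) + 1) =
            (p (i + 1) - 2) * (n - i) := by
          push_cast; ring
        rw [e] at h1
        -- Rounding down loses less than one; since color counts are integers, the floor can be
        -- removed after doubling.
        have h3 : ((p (i + 1) : ℤ) - 2) * (n - i) <
            2 * (((p (i + 1) : ℤ) - 2) * (n - i) / 2) + 2 := by omega
        push_cast at h1 h2
        linarith)
      (by
        intro ht2
        have h2 := two_mul_choose_two (t - 1)
        rw [Nat.cast_sub ht] at h2
        rw [Finset.card_univ, Fintype.card_fin, show t - 2 + 1 = t - 1 by omega]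
        push_cast at h2
        linarith)
    obtain ⟨f, hf⟩ := hF.exists_isRainbowCopy
    exact hno f hf
  · refine max_le (Finset.sup'_le _ _ fun i hi => ?_) ?_
    · obtain ⟨h1, h2⟩ := Finset.mem_Icc.1 hi
      exact (hlow i h1 h2).2
    · rcases Nat.lt_or_ge t 2 with ht2 | ht2
      -- For `t = 1` the last term is at most `2 - n`, whichever value `p 0` has.
      · obtain rfl : t = 1 := by omega
        have : (if p (1 - 1) = 1 then 1 else 2 : ℤ) ≤ 2 := by split_ifs <;> norm_num
        have h4 : (0 : ℤ) ≤ antiRamsey n (starForest fun i : Finset.Icc 1 1 => p i) := by positivity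
        have h5 : (2 : ℤ) ≤ n := by omega
        simp only [Nat.sub_self, Nat.choose_zero_succ] at this ⊢
        push_cast
        linarith
      · exact le_antiRamsey_of_two_stars ht2 (by omega) hanti hpos
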